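/- **Theorem.** Let $\mathcal H$ be a finite-dimensional complex Hilbert space and let $\mathcal E:\mathcal B(\mathcal H)\to\mathcal B(\mathcal H)$ be an arbitrary completely positive trace-preserving (CPTP) linear map, not necessarily unital. Let $\mathcal E^\dagger$ be its adjoint for the Hilbert–Schmidt inner product $\langle X,Y\rangle=\mathrm{Tr}(X^\dagger Y)$, and write $\mathrm{Fix}(\mathcal F)=\{X:\mathcal F(X)=X\}$. Let $\mathcal P_0\subseteq\mathcal H$ be the support of $\mathrm{Fix}(\mathcal E)$, i.e. the span of the ranges of all $X$ and $X^\dagger$ with $X\in\mathrm{Fix}(\mathcal E)$, and let $P_0$ be the orthogonal projector onto $\mathcal P_0$. Identify $\mathcal B(\mathcal P_0)$ with $P_0\mathcal B(\mathcal H)P_0$, and let $\mathcal E_{\mathcal P_0}:\mathcal B(\mathcal P_0)\to\mathcal B(\mathcal P_0)$, $\mathcal E_{\mathcal P_0}(X)=P_0\mathcal E(X)P_0$, be the restriction of $\mathcal E$ to $\mathcal P_0$, with Hilbert–Schmidt adjoint $\mathcal E_{\mathcal P_0}^\dagger$. Then: 1. $\mathcal P_0$ is an invariant subspace under $\mathcal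 E$: if $P_0XP_0=X$, then $P_0\,\mathcal E(X)P_0=\mathcal E(X)$. 2. $\mathcal A:=\mathrm{Fix}(\mathcal E_{\mathcal P_0}^\dagger)$ is a matrix algebra: it is a unital subalgebra of $\mathcal B(\mathcal P_0)$ closed under $\dagger$, and there is a unitary identification $\mathcal P_0\cong\bigoplus_k A_k\otimes B_k$ (finitely many $k$; $A_k,B_k$ nonzero finite-dimensional Hilbert spaces) under which $$\mathcal A=\bigoplus_k \mathcal M_{A_k}\otimes 1_{B_k},$$ where $\mathcal M_{A_k}$ is the algebra of all operators on $A_k$. 3. $\mathrm{Fix}(\mathcal E)$ is a distortion of $\mathcal A$: under the same identification there are positive semidefinite operators $\tau_k$ on $B_k$ with $$\mathrm{Fix}(\mathcal E)=\bigoplus_k \mathcal M_{A_k}\otimes\tau_k ,$$ and there is a CPTP map $\mathcal D$ on $\mathcal B(\mathcal P_0)$ with $\mathcal D\big(\bigoplus_k M_k\otimes 1_{B_k}\big)=\bigoplus_k M_k\otimes\tau_k$ for all $M_k\in\mathcal M_{A_k}$, so that $\mathrm{Fix}(\mathcal E)=\mathcal D(\mathcal A)$. 4. $P_0\,\mathrm{Fix}(\mathcal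 E^\dagger)\,P_0=\mathcal A$. -/

import Mathlib

open scoped Kronecker CStarAlgebra ComplexOrder

noncomputable section

namespace QChannel

section Basic

variable {H : Type*} [NormedAddCommGroup H] [InnerProductSpace ℂ H]

/-- The trace of an operator. -/
def tr (X : H →L[ℂ] H) : ℂ := LinearMap.trace ℂ H (X : H →ₗ[ℂ] H)

/-- A linear map on operators is trace preserving. -/
def IsTracePreserving (T : (H →L[ℂ] H) →ₗ[ℂ] (H →L[ℂ] H)) : Prop :=
  ∀ X, tr (T X) = tr X

/-- The fixed points `Fix(T) = {X | T X = X}` of a linear map on operators. -/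
def Fix (T : (H →L[ℂ] H) →ₗ[ℂ] (H →L[ℂ] H)) : Submodule ℂ (H →L[ℂ] H) :=
  LinearMap.eqLocus T LinearMap.id

variable [FiniteDimensional ℂ H] [CompleteSpace H]

/-- The Hilbert-Schmidt adjoint `T†` of a linear map `T` on operators, expanded in the matrix units
`|e i⟩⟨e j|` of an orthonormal basis: its coefficient at `|e i⟩⟨e j|` is
`⟨T |e i⟩⟨e j|, X⟩ = tr ((T |e i⟩⟨e j|)† X)`.  It is characterized, independently of the basis, by
`tr_adjoint_hsAdjoint_comp` below. -/
def hsAdjoint (T : (H →L[ℂ] H) →ₗ[ℂ] (H →L[ℂ] H)) : (H →L[ℂ] H) →ₗ[ℂ] (H →L[ℂ] H) where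
  toFun X := ∑ i, ∑ j,
    tr ((T (InnerProductSpace.rankOne ℂ (stdOrthonormalBasis ℂ H i)
      (stdOrthonormalBasis ℂ H j))).adjoint ∘L X) •
      InnerProductSpace.rankOne ℂ (stdOrthonormalBasis ℂ H i) (stdOrthonormalBasis ℂ H j)
  map_add' X Y := by
    simp [tr, add_smul, Finset.sum_add_distrib]
  map_smul' c X := by
    simp [tr, Finset.smul_sum, mul_smul]

/-- The support of a set of operators: the span of the ranges of all its members and of their
adjoints, i.e. the smallest subspace with projector `P` such that `P X P = X` for all members. -/
def support (S : Set (H →L[ℂ] H)) : Submodule ℂ H :=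
  ⨆ X ∈ S, (X : H →ₗ[ℂ] H).range ⊔ (X.adjoint : H →ₗ[ℂ] H).range

/-- `Π_P X = P X P`, where `P` also denotes the orthogonal projector onto the subspace `P`. -/
def sandwich (P : Submodule ℂ H) (X : H →L[ℂ] H) : H →L[ℂ] H :=
  P.starProjection ∘L X ∘L P.starProjection

/-- `P` is an invariant subspace under `T`: every operator on `P` is sent to an operator on `P`. -/
def IsInvariantSubspace (T : (H →L[ℂ] H) →ₗ[ℂ] (H →L[ℂ] H)) (P : Submodule ℂ H) : Prop :=
  ∀ X, sandwich P X = X → sandwich P (T X) = T X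

/-- The inclusion of `B(P)` into `B(H)` (extension by zero on the orthogonal complement). -/
def embed (P : Submodule ℂ H) : (P →L[ℂ] P) →ₗ[ℂ] (H →L[ℂ] H) where
  toFun X := P.subtypeL ∘L X ∘L P.orthogonalProjectionOnto
  map_add' X Y := by ext; simp
  map_smul' c X := by ext; simp

/-- The compression of `B(H)` onto `B(P)`. -/
def compress (P : Submodule ℂ H) : (H →L[ℂ] H) →ₗ[ℂ] (P →L[ℂ] P) where
  toFun X := P.orthogonalProjectionOnto ∘L X ∘L P.subtypeL
  map_add' X Y := by ext; simp
  map_smul' c X := by ext; simp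

/-- The restriction `Π_P ∘ T ∘ Π_P` of `T` to `P`, as a map on `B(P)`. -/
def restrict (T : (H →L[ℂ] H) →ₗ[ℂ] (H →L[ℂ] H)) (P : Submodule ℂ H) :
    (P →L[ℂ] P) →ₗ[ℂ] (P →L[ℂ] P) :=
  compress P ∘ₗ T ∘ₗ embed P

end Basic

section Blocks

/-- A decomposition `K ≅ ⨁ₖ Aₖ ⊗ Bₖ` of a Hilbert space into finitely many sectors, where
`Aₖ = ℂ^(d k)` and `Bₖ = ℂ^(n k)` are nonzero: a unitary onto the Hilbert space with
orthonormal basis indexed by the triples `(k, a, b)`. -/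
structure SectorDecomposition (K : Type*) [NormedAddCommGroup K] [InnerProductSpace ℂ K] where
  sectors : ℕ
  d : Fin sectors → ℕ
  n : Fin sectors → ℕ
  d_pos : ∀ k, 0 < d k
  n_pos : ∀ k, 0 < n k
  U : K ≃ₗᵢ[ℂ] EuclideanSpace ℂ (Σ k : Fin sectors, Fin (d k) × Fin (n k))

variable {K : Type*} [NormedAddCommGroup K] [InnerProductSpace ℂ K]

namespace SectorDecomposition

/-- The operator on `K` that corresponds to `⨁ₖ M k ⊗ N k`. -/
def op (σ : SectorDecomposition K) (M : ∀ k, Matrix (Fin (σ.d k)) (Fin (σ.d k)) ℂ)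
    (N : ∀ k, Matrix (Fin (σ.n k)) (Fin (σ.n k)) ℂ) : K →L[ℂ] K :=
  (σ.U.symm.toContinuousLinearEquiv : _ →L[ℂ] K) ∘L
    Matrix.toEuclideanCLM (𝕜 := ℂ) (Matrix.blockDiagonal' fun k => M k ⊗ₖ N k) ∘L
    (σ.U.toContinuousLinearEquiv : K →L[ℂ] _)

/-- The set `⨁ₖ M_{Aₖ} ⊗ τₖ` of all operators `⨁ₖ M k ⊗ τ k`, with `τ` fixed. -/
def blockSet (σ : SectorDecomposition K) (τ : ∀ k, Matrix (Fin (σ.n k)) (Fin (σ.n k)) ℂ) :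
    Set (K →L[ℂ] K) :=
  Set.range fun M => σ.op M τ

variable [CompleteSpace K]

/-- `D` is a distortion map for the algebra `⨁ₖ M_{Aₖ} ⊗ 1_{Bₖ}`, with distorting matrices `τ`:
a completely positive trace preserving map that sends `⨁ₖ M k ⊗ 1` to `⨁ₖ M k ⊗ τ k`, where the
positive semidefinite matrices `τ k` do not depend on `M`. -/
def IsDistortionMap (σ : SectorDecomposition K)
    (τ : ∀ k, Matrix (Fin (σ.n k)) (Fin (σ.n k)) ℂ)
    (D : (K →L[ℂ] K) →CP (K →L[ℂ] K)) : Prop :=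
  IsTracePreserving D.toLinearMap ∧ (∀ k, (τ k).PosSemidef) ∧ ∀ M, D (σ.op M 1) = σ.op M τ

end SectorDecomposition

end Blocks

section Facts

variable {H : Type*} [NormedAddCommGroup H] [InnerProductSpace ℂ H]

theorem tr_sum {ι : Type*} (s : Finset ι) (f : ι → H →L[ℂ] H) :
    tr (∑ i ∈ s, f i) = ∑ i ∈ s, tr (f i) := by
  simp [tr]

theorem tr_smul (c : ℂ) (X : H →L[ℂ] H) : tr (c • X) = c * tr X := by
  simp [tr]

theorem tr_comp_comm (X Y : H →L[ℂ] H) : tr (X ∘L Y) = tr (Y ∘L X) :=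
  LinearMap.trace_mul_comm ℂ (X : H →ₗ[ℂ] H) Y

theorem op_eq_sum_rankOne {ι : Type*} [Fintype ι] (b : OrthonormalBasis ι ℂ H) (X : H →L[ℂ] H) :
    X = ∑ i, ∑ j, inner ℂ (b i) (X (b j)) • InnerProductSpace.rankOne ℂ (b i) (b j) := by
  classical
  refine ContinuousLinearMap.coe_injective (b.toBasis.ext fun l => ?_)
  have h := (b.sum_repr' (X (b l))).symm
  simpa [InnerProductSpace.rankOne_apply, b.inner_eq_ite] using h

variable [FiniteDimensional ℂ H]

theorem tr_comp_rankOne (X : H →L[ℂ] H) (x y : H) :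
    tr (X ∘L InnerProductSpace.rankOne ℂ x y) = inner ℂ y (X x) := by
  simp [tr, LinearMap.trace_eq_sum_inner _ (stdOrthonormalBasis ℂ H),
    InnerProductSpace.rankOne_apply, inner_smul_right, OrthonormalBasis.sum_inner_mul_inner]

variable [CompleteSpace H]

theorem tr_adjoint (X : H →L[ℂ] H) : tr X.adjoint = star (tr X) := by
  simp [tr, LinearMap.trace_eq_sum_inner _ (stdOrthonormalBasis ℂ H),
    ContinuousLinearMap.adjoint_inner_right]

theorem hsAdjoint_apply (T : (H →L[ℂ] H) →ₗ[ℂ] (H →L[ℂ] H)) (X : H →L[ℂ] H) :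
    hsAdjoint T X = ∑ i, ∑ j,
      tr ((T (InnerProductSpace.rankOne ℂ (stdOrthonormalBasis ℂ H i)
        (stdOrthonormalBasis ℂ H j))).adjoint ∘L X) •
        InnerProductSpace.rankOne ℂ (stdOrthonormalBasis ℂ H i) (stdOrthonormalBasis ℂ H j) :=
  rfl

/-- The defining property of the Hilbert-Schmidt adjoint: `⟨T† X, Y⟩ = ⟨X, T Y⟩` for the
inner product `⟨X, Y⟩ = tr (X† Y)`. -/
theorem tr_adjoint_hsAdjoint_comp (T : (H →L[ℂ] H) →ₗ[ℂ] (H →L[ℂ] H)) (X Y : H →L[ℂ] H) :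
    tr ((hsAdjoint T X).adjoint ∘L Y) = tr (X.adjoint ∘L T Y) := by
  have h1 : tr (Y.adjoint ∘L hsAdjoint T X) = ∑ i, ∑ j,
      tr ((T (InnerProductSpace.rankOne ℂ (stdOrthonormalBasis ℂ H i)
        (stdOrthonormalBasis ℂ H j))).adjoint ∘L X) *
      inner ℂ (stdOrthonormalBasis ℂ H j) (Y.adjoint (stdOrthonormalBasis ℂ H i)) := by
    simp only [hsAdjoint_apply, ContinuousLinearMap.comp_finsetSum,
      ContinuousLinearMap.comp_smul, tr_sum, tr_smul, tr_comp_rankOne]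
  have h2 : tr (X.adjoint ∘L T Y) = ∑ i, ∑ j,
      inner ℂ (stdOrthonormalBasis ℂ H i) (Y (stdOrthonormalBasis ℂ H j)) *
      tr (X.adjoint ∘L T (InnerProductSpace.rankOne ℂ (stdOrthonormalBasis ℂ H i)
        (stdOrthonormalBasis ℂ H j))) := by
    conv_lhs => rw [op_eq_sum_rankOne (stdOrthonormalBasis ℂ H) Y]
    simp only [map_sum, map_smul, ContinuousLinearMap.comp_finsetSum,
      ContinuousLinearMap.comp_smul, tr_sum, tr_smul]
  have h3 : tr ((hsAdjoint T X).adjoint ∘L Y) = star (tr (Y.adjoint ∘L hsAdjoint T X)) := by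
    rw [← tr_adjoint, ContinuousLinearMap.adjoint_comp, ContinuousLinearMap.adjoint_adjoint]
  rw [h3, h1, h2, star_sum]
  refine Finset.sum_congr rfl fun i _ => ?_
  rw [star_sum]
  refine Finset.sum_congr rfl fun j _ => ?_
  rw [star_mul', ← tr_adjoint, ContinuousLinearMap.adjoint_comp,
    ContinuousLinearMap.adjoint_adjoint, ContinuousLinearMap.adjoint_inner_right, mul_comm]
  congr 1
  exact inner_conj_symm _ _

/-- If `T ρ = ∑ᵢ Eᵢ ρ Eᵢ†` then `T† X = ∑ᵢ Eᵢ† X Eᵢ`. -/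
theorem hsAdjoint_of_kraus {ι : Type*} [Fintype ι] (T : (H →L[ℂ] H) →ₗ[ℂ] (H →L[ℂ] H))
    (E : ι → H →L[ℂ] H) (hT : ∀ ρ, T ρ = ∑ i, E i ∘L ρ ∘L (E i).adjoint) (X : H →L[ℂ] H) :
    hsAdjoint T X = ∑ i, (E i).adjoint ∘L X ∘L E i := by
  have key : ∀ Y : H →L[ℂ] H, tr ((hsAdjoint T X).adjoint ∘L Y) =
      tr ((∑ i, (E i).adjoint ∘L X ∘L E i).adjoint ∘L Y) := by
    intro Y
    rw [tr_adjoint_hsAdjoint_comp, hT]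
    simp only [map_sum, ContinuousLinearMap.comp_finsetSum, ContinuousLinearMap.finsetSum_comp,
      tr_sum, ContinuousLinearMap.adjoint_comp, ContinuousLinearMap.adjoint_adjoint]
    refine Finset.sum_congr rfl fun i _ => ?_
    rw [← ContinuousLinearMap.comp_assoc, ← ContinuousLinearMap.comp_assoc, tr_comp_comm]
    simp only [ContinuousLinearMap.comp_assoc]
  ext y
  refine ext_inner_right ℂ fun x => ?_
  have := key (InnerProductSpace.rankOne ℂ x y)
  rwa [tr_comp_rankOne, tr_comp_rankOne, ContinuousLinearMap.adjoint_inner_right,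
    ContinuousLinearMap.adjoint_inner_right] at this

end Facts

end QChannel

end

noncomputable section

namespace QChannel

/-! Write the channel in Kraus form, `E X = ∑ Kᵢ X Kᵢ†`. For a selfadjoint fixed point `X`, the
operator `E X⁺` is positive, dominates `X` and has the trace of `X⁺`; the only such operator is `X⁺`
itself (`eq_posPart_of_tr_eq`). Hence positive fixed points span `Fix E`, and one of them, `ρ`, has
the whole support `P₀` as its range. Since `Kᵢ ρ Kᵢ† ≤ ρ`, every `Kᵢ†` preserves `ker ρ`, so every
`Kᵢ` preserves `P₀`. This gives invariance, and makes the compressed `Kᵢ` a channel on `P₀` with a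
faithful fixed point.

For such a channel, `∑ [Kᵢ, X]†[Kᵢ, X] = E†(X†X) - X†X` whenever `E† X = X`; pairing with `ρ` kills
the right side, and faithfulness forces every commutator to vanish. So `A` is the commutant of the
Kraus operators and their adjoints (`Fix_hsAdjoint_eq_centralizer`). Its block form comes from
splitting the space into minimal reducing subspaces: by Schur's lemma the commutant acts by scalars
within an equivalence class and vanishes between classes (`exists_sectorDecomposition`).

The channel is an `A`-bimodule map, so conjugating `ρ` by matrix units of `A` produces a fixed point
`1 ⊗ τ`. Multiplying by `A` gives all `M ⊗ τ`, and `dim Fix E = dim Fix E†` shows that nothing else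
is fixed (`exists_Fix_eq_blockSet`).

For the compression of `Fix E†`, the same dimension count reduces the claim to injectivity. A fixed
point of `E†` with zero compression annihilates `Fix E`, hence has the form `E† Z - Z`; it vanishes
because the orbit of `Z` under a unital positive map is bounded (`eq_zero_of_krausMap_eq_add`). -/

theorem exists_eq_star_mul_self_of_nonneg {A : Type*} [NonUnitalCStarAlgebra A] [PartialOrder A]
    [StarOrderedRing A] {a : A} (ha : 0 ≤ a) : ∃ b, a = star b * b :=
  CStarAlgebra.nonneg_iff_eq_star_mul_self.1 ha

/-! ### Kraus form of completely positive maps -/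

section Kraus

variable {H : Type*} [NormedAddCommGroup H] [InnerProductSpace ℂ H] [CompleteSpace H]
variable {ι : Type*} [Fintype ι]

/-- The map `X ↦ ∑ᵢ Kᵢ X Kᵢ†`. -/
def krausMap (K : ι → H →L[ℂ] H) : (H →L[ℂ] H) →ₗ[ℂ] (H →L[ℂ] H) where
  toFun X := ∑ i, K i * X * star (K i)
  map_add' X Y := by simp [mul_add, add_mul, Finset.sum_add_distrib]
  map_smul' c X := by simp [Finset.smul_sum]

theorem krausMap_apply (K : ι → H →L[ℂ] H) (X : H →L[ℂ] H) :
    krausMap K X = ∑ i, K i * X * star (K i) := rfl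

theorem krausMap_star (K : ι → H →L[ℂ] H) (X : H →L[ℂ] H) :
    krausMap K (star X) = star (krausMap K X) := by
  simp [krausMap_apply, mul_assoc]

theorem krausMap_nonneg (K : ι → H →L[ℂ] H) {X : H →L[ℂ] H} (hX : 0 ≤ X) :
    0 ≤ krausMap K X :=
  Finset.sum_nonneg fun i _ => star_right_conjugate_nonneg hX (K i)

/-- `krausMap K` as a completely positive map. -/
def krausCP (K : ι → H →L[ℂ] H) : (H →L[ℂ] H) →CP (H →L[ℂ] H) where
  toLinearMap := krausMap K
  map_cstarMatrix_nonneg' k M hM := by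
    classical
    -- Entrywise application of `X ↦ Kᵢ X Kᵢ†` is conjugation by the diagonal matrix with all
    -- entries `Kᵢ`, and conjugation preserves positivity.
    let C (i : ι) : CStarMatrix (Fin k) (Fin k) (H →L[ℂ] H) :=
      CStarMatrix.ofMatrix (Matrix.diagonal fun _ => K i)
    have hC (i : ι) (a b : Fin k) : (C i * M * star (C i)) a b = K i * M a b * star (K i) := by
      have h : star (C i) = CStarMatrix.ofMatrix (Matrix.diagonal fun _ => star (K i)) :=
        Matrix.diagonal_conjTranspose _
      rw [h]
      exact (Matrix.mul_diagonal _ _ _ _).trans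
        (congrArg (· * star (K i)) (Matrix.diagonal_mul _ _ _ _))
    have h : M.map (krausMap K) = ∑ i, C i * M * star (C i) := by
      refine CStarMatrix.ext fun a b => ?_
      refine Eq.trans ?_ (Matrix.sum_apply a b Finset.univ fun i => C i * M * star (C i)).symm
      exact Finset.sum_congr rfl fun i _ => (hC i a b).symm
    rw [h]
    exact Finset.sum_nonneg fun i _ => star_right_conjugate_nonneg hM _

theorem krausCP_toLinearMap (K : ι → H →L[ℂ] H) : (krausCP K).toLinearMap = krausMap K := rfl

theorem krausCP_apply (K : ι → H →L[ℂ] H) (X : H →L[ℂ] H) : krausCP K X = krausMap K X := rfl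

/-- Choi's theorem: completely positive maps have a Kraus decomposition. -/
theorem exists_krausMap_eq [FiniteDimensional ℂ H] (E : (H →L[ℂ] H) →CP (H →L[ℂ] H)) :
    ∃ (n : ℕ) (K : Fin n × Fin n → H →L[ℂ] H), E.toLinearMap = krausMap K := by
  classical
  let b := stdOrthonormalBasis ℂ H
  refine ⟨Module.finrank ℂ H, ?_⟩
  rcases Nat.eq_zero_or_pos (Module.finrank ℂ H) with h0 | hpos
  · have : Subsingleton H := Module.finrank_zero_iff.1 h0
    exact ⟨0, LinearMap.ext fun X => Subsingleton.elim _ _⟩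
  let z : Fin (Module.finrank ℂ H) := ⟨0, hpos⟩
  -- Only row `z` of `C` is nonzero, and `C† C` is the matrix of all matrix units `|b i⟩⟨b j|`. Its
  -- image under `E` is the Choi matrix, whose positivity yields the factor `B`.
  let C : CStarMatrix (Fin (Module.finrank ℂ H)) (Fin (Module.finrank ℂ H)) (H →L[ℂ] H) :=
    CStarMatrix.ofMatrix fun m j => if m = z then InnerProductSpace.rankOne ℂ (b z) (b j) else 0
  have hC : ∀ i j, (star C * C) i j = InnerProductSpace.rankOne ℂ (b i) (b j) := by
    intro i j
    rw [CStarMatrix.mul_apply, Finset.sum_eq_single z]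
    · change star (if z = z then InnerProductSpace.rankOne ℂ (b z) (b i) else 0) *
        (if z = z then InnerProductSpace.rankOne ℂ (b z) (b j) else 0) = _
      rw [if_pos rfl, if_pos rfl]
      ext x
      simp [ContinuousLinearMap.star_eq_adjoint, InnerProductSpace.rankOne_apply]
    · intro m _ hm
      change star (if m = z then InnerProductSpace.rankOne ℂ (b z) (b i) else 0) *
        (if m = z then InnerProductSpace.rankOne ℂ (b z) (b j) else 0) = _
      simp [hm]
    · simp
  have hpos' := E.map_cstarMatrix_nonneg _ (star_mul_self_nonneg C)
  obtain ⟨B, hB⟩ := exists_eq_star_mul_self_of_nonneg hpos'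
  have hE : ∀ i j, E.toLinearMap (InnerProductSpace.rankOne ℂ (b i) (b j)) =
      ∑ k, star (B k i) * B k j := by
    intro i j
    have := congrArg (fun M => M i j) hB
    simp only [CStarMatrix.map_apply, hC, CStarMatrix.mul_apply] at this
    exact this
  -- The entries of `B` are operators, not scalars, so the identity `∑ₘ |b m⟩⟨b m|` is inserted in
  -- `B k i† B k j`; this accounts for the second index of the Kraus family.
  refine ⟨fun p => ∑ i, star (B p.1 i) * InnerProductSpace.rankOne ℂ (b p.2) (b i), ?_⟩
  refine LinearMap.ext fun X => ?_
  rw [krausMap_apply]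
  have hX := op_eq_sum_rankOne b X
  conv_lhs => rw [hX]
  simp only [map_sum, map_smul, hE, Fintype.sum_prod_type, star_sum, star_mul, star_star,
    Finset.sum_mul, Finset.mul_sum]
  have hr : ∀ k m i j, star (B k i) * InnerProductSpace.rankOne ℂ (b m) (b i) * X *
      (star (InnerProductSpace.rankOne ℂ (b m) (b j)) * B k j) =
      inner ℂ (b i) (X (b j)) • (star (B k i) * InnerProductSpace.rankOne ℂ (b m) (b m) * B k j) := by
    intro k m i j
    ext x
    simp [ContinuousLinearMap.star_eq_adjoint, InnerProductSpace.rankOne_apply, smul_smul, mul_comm]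
  have hid : ∑ m, InnerProductSpace.rankOne ℂ (b m) (b m) = (1 : H →L[ℂ] H) := by
    ext x
    simpa [InnerProductSpace.rankOne_apply, sum_apply] using b.sum_repr' x
  simp only [hr, Finset.smul_sum]
  have hk : ∀ k i j, star (B k i) * B k j =
      ∑ m, star (B k i) * InnerProductSpace.rankOne ℂ (b m) (b m) * B k j := by
    intro k i j
    rw [← Finset.sum_mul, ← Finset.mul_sum, hid, mul_one]
  simp only [hk, Finset.smul_sum]
  rw [Finset.sum_congr rfl fun i _ => Finset.sum_comm, Finset.sum_comm]
  refine Finset.sum_congr rfl fun k _ => ?_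
  rw [Finset.sum_congr rfl fun i _ => Finset.sum_comm, Finset.sum_comm]
  exact Finset.sum_congr rfl fun m _ => Finset.sum_comm

end Kraus

/-! ### Positive operators, kernels and traces -/

section Positive

variable {H : Type*} [NormedAddCommGroup H] [InnerProductSpace ℂ H]

theorem tr_mul_comm (X Y : H →L[ℂ] H) : tr (X * Y) = tr (Y * X) := tr_comp_comm X Y

theorem tr_add (X Y : H →L[ℂ] H) : tr (X + Y) = tr X + tr Y := by simp [tr]

theorem tr_sub (X Y : H →L[ℂ] H) : tr (X - Y) = tr X - tr Y := by simp [tr]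

theorem mem_Fix {T : (H →L[ℂ] H) →ₗ[ℂ] (H →L[ℂ] H)} {X : H →L[ℂ] H} : X ∈ Fix T ↔ T X = X :=
  Iff.rfl

theorem apply_eq_zero_of_inner_eq_zero [CompleteSpace H] {X : H →L[ℂ] H} (hX : 0 ≤ X) {x : H}
    (hx : inner ℂ x (X x) = 0) : X x = 0 := by
  obtain ⟨B, rfl⟩ := exists_eq_star_mul_self_of_nonneg hX
  rw [mul_apply_eq_comp, ContinuousLinearMap.star_eq_adjoint,
    ContinuousLinearMap.adjoint_inner_right, inner_self_eq_zero] at hx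
  rw [mul_apply_eq_comp, hx, map_zero]

theorem apply_eq_zero_of_le [CompleteSpace H] {X Y : H →L[ℂ] H} (hX : 0 ≤ X) (hXY : X ≤ Y)
    {x : H} (hx : Y x = 0) : X x = 0 := by
  have h1 := ((ContinuousLinearMap.nonneg_iff_isPositive X).1 hX).inner_nonneg_right x
  have h2 := ((ContinuousLinearMap.le_def X Y).1 hXY).inner_nonneg_right x
  rw [sub_apply, hx, zero_sub, inner_neg_right, Left.nonneg_neg_iff] at h2
  exact apply_eq_zero_of_inner_eq_zero hX (le_antisymm h2 h1)

theorem tr_nonneg {X : H →L[ℂ] H} (hX : 0 ≤ X) : 0 ≤ tr X :=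
  ((ContinuousLinearMap.nonneg_iff_isPositive X).1 hX).toLinearMap.trace_nonneg

variable [FiniteDimensional ℂ H]

/-- The trace form `(X, Y) ↦ tr (X Y)` is nondegenerate. -/
theorem eq_of_forall_tr_mul_eq {X Y : H →L[ℂ] H} (h : ∀ Z, tr (X * Z) = tr (Y * Z)) : X = Y := by
  ext x
  refine ext_inner_left ℂ fun y => ?_
  have := h (InnerProductSpace.rankOne ℂ x y)
  rwa [ContinuousLinearMap.mul_def, tr_comp_rankOne, ContinuousLinearMap.mul_def,
    tr_comp_rankOne] at this

variable [CompleteSpace H]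

theorem eq_zero_of_tr_eq_zero {X : H →L[ℂ] H} (hX : 0 ≤ X) (h : tr X = 0) : X = 0 := by
  let b := stdOrthonormalBasis ℂ H
  have hp := (ContinuousLinearMap.nonneg_iff_isPositive X).1 hX
  rw [tr, LinearMap.trace_eq_sum_inner _ b] at h
  have h0 := (Finset.sum_eq_zero_iff_of_nonneg fun i _ => hp.inner_nonneg_right (b i)).1 h
  refine ContinuousLinearMap.coe_injective (b.toBasis.ext fun i => ?_)
  simpa using apply_eq_zero_of_inner_eq_zero hX (h0 i (Finset.mem_univ i))

theorem range_eq_orthogonal_ker {X : H →L[ℂ] H} (hX : IsSelfAdjoint X) :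
    (X : H →ₗ[ℂ] H).range = (X : H →ₗ[ℂ] H).kerᗮ := by
  have h := ContinuousLinearMap.orthogonal_range X
  rw [hX.adjoint_eq] at h
  rw [← h, Submodule.orthogonal_orthogonal]

/-- Domination reverses the inclusion of kernels, and ranges of selfadjoint operators are the
orthogonal complements of kernels. -/
theorem range_le_range_of_le {X Y : H →L[ℂ] H} (hX : 0 ≤ X) (hXY : X ≤ Y) :
    (X : H →ₗ[ℂ] H).range ≤ (Y : H →ₗ[ℂ] H).range := by
  rw [range_eq_orthogonal_ker (IsSelfAdjoint.of_nonneg hX),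
    range_eq_orthogonal_ker (IsSelfAdjoint.of_nonneg (hX.trans hXY))]
  exact Submodule.orthogonal_le fun x hx => apply_eq_zero_of_le hX hXY hx

theorem mul_eq_zero_of_tr_mul_mul {X P : H →L[ℂ] H} (hX : 0 ≤ X) (hP : IsStarProjection P)
    (h : tr (P * X) = 0) : P * X = 0 := by
  have hPs : star P = P := hP.isSelfAdjoint
  have h0 : P * X * star P = 0 := by
    refine eq_zero_of_tr_eq_zero (star_right_conjugate_nonneg hX P) ?_
    rw [tr_mul_comm, ← mul_assoc, hPs, hP.isIdempotentElem.eq, h]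
  have h1 : X * P = 0 := by
    ext x
    refine apply_eq_zero_of_inner_eq_zero hX ?_
    have := congrArg (fun Z : H →L[ℂ] H => inner ℂ x (Z x)) h0
    rw [hPs] at this
    change inner ℂ (P x) (X (P x)) = 0
    rw [← ContinuousLinearMap.adjoint_inner_right, hP.isSelfAdjoint.adjoint_eq]
    simpa using this
  have := congrArg star h1
  rwa [star_mul, hPs, (IsSelfAdjoint.of_nonneg hX).star_eq, star_zero] at this

/-- The positive part of a selfadjoint operator has the least trace among all positive `Q` with
`Q - X` positive, and is the only one with that trace. -/
theorem eq_posPart_of_tr_eq {X Q : H →L[ℂ] H} (hX : IsSelfAdjoint X) (hQ : 0 ≤ Q) (hXQ : X ≤ Q)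
    (h : tr Q = tr X⁺) : Q = X⁺ := by
  have hp : (0 : H →L[ℂ] H) ≤ X⁺ := CFC.posPart_nonneg X
  let P : H →L[ℂ] H := ((X⁺ : H →L[ℂ] H) : H →ₗ[ℂ] H).range.starProjection
  have hP : IsStarProjection P := isStarProjection_starProjection
  have hPs : star P = P := hP.isSelfAdjoint
  have h1 : P * X⁺ = X⁺ := by
    ext x
    exact Submodule.starProjection_eq_self_iff.2 ⟨x, rfl⟩
  have h2 : P * X⁻ = 0 := by
    ext x
    refine (Submodule.starProjection_apply_eq_zero_iff _).2 ?_
    rintro _ ⟨y, rfl⟩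
    change inner ℂ (X⁺ y) (X⁻ x) = 0
    rw [← ContinuousLinearMap.adjoint_inner_right, (IsSelfAdjoint.of_nonneg hp).adjoint_eq,
      ← mul_apply_eq_comp, CFC.posPart_mul_negPart]
    simp
  have hPX : P * X = X⁺ := by
    conv_lhs => rw [← CFC.posPart_sub_negPart X hX]
    rw [mul_sub, h1, h2, sub_zero]
  have hR : 0 ≤ Q - X := sub_nonneg.2 hXQ
  have hPc : IsStarProjection (1 - P) := hP.one_sub
  have hnn : ∀ {P Y : H →L[ℂ] H}, IsStarProjection P → 0 ≤ Y → 0 ≤ tr (P * Y) := by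
    intro P Y hP hY
    have := tr_nonneg (star_right_conjugate_nonneg hY P)
    rwa [hP.isSelfAdjoint.star_eq, tr_mul_comm, ← mul_assoc, hP.isIdempotentElem.eq] at this
  -- The sum equals `tr Q - tr X⁺`, because `P X = X⁺`. Both terms are nonnegative, so both vanish:
  -- this gives `P Q = Q` and `P Q = P X = X⁺`.
  have e : tr (P * (Q - X)) + tr ((1 - P) * Q) = 0 := by
    rw [← tr_add, mul_sub, hPX, sub_mul, one_mul, sub_add_sub_cancel', tr_sub, h, sub_self]
  have e1 : tr ((1 - P) * Q) = 0 :=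
    ((add_eq_zero_iff_of_nonneg (hnn hP hR) (hnn hPc hQ)).1 e).2
  have e2 : tr (P * (Q - X)) = 0 :=
    ((add_eq_zero_iff_of_nonneg (hnn hP hR) (hnn hPc hQ)).1 e).1
  have f1 := mul_eq_zero_of_tr_mul_mul hQ hPc e1
  have f2 := mul_eq_zero_of_tr_mul_mul hR hP e2
  rw [sub_mul, one_mul, sub_eq_zero] at f1
  rw [mul_sub, hPX, ← f1, sub_eq_zero] at f2
  exact f2

end Positive

/-! ### Positive fixed points and the support -/

section Channel

variable {H : Type*} [NormedAddCommGroup H] [InnerProductSpace ℂ H] [CompleteSpace H] {ι : Type*}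
  [Fintype ι]

theorem star_mem_Fix_krausMap {K : ι → H →L[ℂ] H} {X : H →L[ℂ] H} (hX : X ∈ Fix (krausMap K)) :
    star X ∈ Fix (krausMap K) := by
  rw [mem_Fix, krausMap_star, mem_Fix.1 hX]

theorem tr_krausMap_mul (K : ι → H →L[ℂ] H) (X Y : H →L[ℂ] H) :
    tr (X * krausMap K Y) = tr ((∑ i, star (K i) * X * K i) * Y) := by
  simp only [krausMap_apply, Finset.mul_sum, Finset.sum_mul, tr_sum]
  refine Finset.sum_congr rfl fun i _ => ?_
  rw [← mul_assoc, ← mul_assoc, tr_mul_comm]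
  simp only [mul_assoc]

variable [FiniteDimensional ℂ H]

theorem hsAdjoint_krausMap (K : ι → H →L[ℂ] H) (X : H →L[ℂ] H) :
    hsAdjoint (krausMap K) X = ∑ i, star (K i) * X * K i := by
  rw [hsAdjoint_of_kraus (krausMap K) K fun _ => rfl]
  rfl

theorem isTracePreserving_krausMap_iff (K : ι → H →L[ℂ] H) :
    IsTracePreserving (krausMap K) ↔ ∑ i, star (K i) * K i = 1 := by
  have h : ∀ X, tr (krausMap K X) = tr ((∑ i, star (K i) * K i) * X) := fun X => by
    simpa using tr_krausMap_mul K 1 X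
  constructor
  · intro hK
    exact eq_of_forall_tr_mul_eq fun Z => by rw [← h, hK, one_mul]
  · intro hK X
    rw [h, hK, one_mul]

theorem posPart_mem_Fix_krausMap {K : ι → H →L[ℂ] H} (hK : IsTracePreserving (krausMap K))
    {X : H →L[ℂ] H} (hX : IsSelfAdjoint X) (hfix : X ∈ Fix (krausMap K)) :
    X⁺ ∈ Fix (krausMap K) := by
  refine eq_posPart_of_tr_eq hX (krausMap_nonneg K (CFC.posPart_nonneg X)) ?_ (hK _)
  have h := krausMap_nonneg K (CFC.negPart_nonneg X)
  have e : X = krausMap K X⁺ - krausMap K X⁻ := by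
    rw [← map_sub, CFC.posPart_sub_negPart X hX, mem_Fix.1 hfix]
  conv_lhs => rw [e]
  exact sub_le_self _ h

/-- The fixed points of a channel are spanned by the positive ones. -/
theorem Fix_krausMap_le_span {K : ι → H →L[ℂ] H} (hK : IsTracePreserving (krausMap K)) :
    Fix (krausMap K) ≤ Submodule.span ℂ {X | 0 ≤ X ∧ X ∈ Fix (krausMap K)} := by
  have key : ∀ X, IsSelfAdjoint X → X ∈ Fix (krausMap K) →
      X ∈ Submodule.span ℂ {X | 0 ≤ X ∧ X ∈ Fix (krausMap K)} := by
    intro X hX hfix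
    have hp := posPart_mem_Fix_krausMap hK hX hfix
    have hn : X⁻ ∈ Fix (krausMap K) := by
      rw [← CFC.posPart_neg]
      exact posPart_mem_Fix_krausMap hK hX.neg (neg_mem hfix)
    rw [← CFC.posPart_sub_negPart X hX]
    exact sub_mem (Submodule.subset_span ⟨CFC.posPart_nonneg X, hp⟩)
      (Submodule.subset_span ⟨CFC.negPart_nonneg X, hn⟩)
  intro X hX
  have hs := star_mem_Fix_krausMap hX
  -- Splitting into selfadjoint fixed points reduces the claim to `key`.
  have e : X = (1 / 2 : ℂ) • (X + star X) + (-Complex.I / 2) • (Complex.I • (X - star X)) := by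
    rw [smul_smul, show -Complex.I / 2 * Complex.I = 1 / 2 by
      rw [div_mul_eq_mul_div, neg_mul, Complex.I_mul_I, neg_neg]]
    module
  rw [e]
  refine add_mem (Submodule.smul_mem _ _ (key _ (IsSelfAdjoint.add_star_self X) (add_mem hX hs)))
    (Submodule.smul_mem _ _ (key _ ?_ (Submodule.smul_mem _ _ (sub_mem hX hs))))
  rw [isSelfAdjoint_iff, star_smul, star_sub, star_star, Complex.star_def, Complex.conj_I]
  module

/-- The support of the fixed points of a channel is the range of a positive fixed point. -/
theorem exists_range_eq_support {K : ι → H →L[ℂ] H} (hK : IsTracePreserving (krausMap K)) :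
    ∃ ρ : H →L[ℂ] H, 0 ≤ ρ ∧ ρ ∈ Fix (krausMap K) ∧
      (ρ : H →ₗ[ℂ] H).range = support (Fix (krausMap K) : Set (H →L[ℂ] H)) := by
  -- Take `ρ` with maximal range. For another positive fixed point `σ`, the range of `ρ + σ`
  -- contains both ranges, so maximality puts the range of `σ` inside that of `ρ`.
  obtain ⟨V, ⟨ρ, hρ, hfix, rfl⟩, hmax⟩ := WellFounded.has_min
    (wellFounded_gt : WellFounded fun x y : Submodule ℂ H => x > y)
    {V | ∃ ρ : H →L[ℂ] H, 0 ≤ ρ ∧ ρ ∈ Fix (krausMap K) ∧ (ρ : H →ₗ[ℂ] H).range = V}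
    ⟨_, 0, le_rfl, zero_mem _, rfl⟩
  refine ⟨ρ, hρ, hfix, le_antisymm ?_ ?_⟩
  · exact le_trans le_sup_left (le_iSup₂_of_le ρ hfix le_rfl)
  have hpos : ∀ σ : H →L[ℂ] H, 0 ≤ σ → σ ∈ Fix (krausMap K) →
      (σ : H →ₗ[ℂ] H).range ≤ (ρ : H →ₗ[ℂ] H).range := by
    intro σ hσ hσf
    have h1 : (ρ : H →ₗ[ℂ] H).range ≤ ((ρ + σ : H →L[ℂ] H) : H →ₗ[ℂ] H).range :=
      range_le_range_of_le hρ (le_add_of_nonneg_right hσ)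
    have h2 : (σ : H →ₗ[ℂ] H).range ≤ ((ρ + σ : H →L[ℂ] H) : H →ₗ[ℂ] H).range :=
      range_le_range_of_le hσ (le_add_of_nonneg_left hρ)
    have h3 := hmax _ ⟨ρ + σ, add_nonneg hρ hσ, add_mem hfix hσf, rfl⟩
    exact h2.trans (not_lt_iff_le_imp_ge.1 h3 h1)
  have hall : ∀ X ∈ Fix (krausMap K), (X : H →ₗ[ℂ] H).range ≤ (ρ : H →ₗ[ℂ] H).range := by
    intro X hX
    have hs := Fix_krausMap_le_span hK hX
    clear hX
    induction hs using Submodule.span_induction with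
    | mem X h => exact hpos X h.1 h.2
    | zero => rintro _ ⟨y, rfl⟩; exact zero_mem _
    | add X Y _ _ h1 h2 => rintro _ ⟨y, rfl⟩; exact add_mem (h1 ⟨y, rfl⟩) (h2 ⟨y, rfl⟩)
    | smul c X _ h => rintro _ ⟨y, rfl⟩; exact Submodule.smul_mem _ _ (h ⟨y, rfl⟩)
  exact iSup₂_le fun X hX => sup_le (hall X hX) (hall _ (star_mem_Fix_krausMap hX))

end Channel

/-! ### Duality for the trace form -/

section Duality

variable {H : Type*} [NormedAddCommGroup H] [InnerProductSpace ℂ H]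

/-- The trace form `Z ↦ (Y ↦ tr (Z Y))`. -/
def traceForm : (H →L[ℂ] H) →ₗ[ℂ] Module.Dual ℂ (H →L[ℂ] H) :=
  LinearMap.mk₂ ℂ (fun Z Y => tr (Z * Y)) (fun X Y Z => by rw [add_mul, tr_add])
    (fun c X Y => by rw [smul_mul_assoc, tr_smul, smul_eq_mul])
    (fun X Y Z => by rw [mul_add, tr_add])
    (fun c X Y => by rw [mul_smul_comm, tr_smul, smul_eq_mul])

theorem Fix_eq_ker (T : (H →L[ℂ] H) →ₗ[ℂ] (H →L[ℂ] H)) : Fix T = (T - LinearMap.id).ker :=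
  LinearMap.eqLocus_eq_ker_sub _ _

/-- `S` is the transpose of `T` for the trace form. -/
def IsTraceTranspose (S T : (H →L[ℂ] H) →ₗ[ℂ] (H →L[ℂ] H)) : Prop :=
  ∀ X Y, tr (S X * Y) = tr (X * T Y)

theorem IsTraceTranspose.traceForm_comp {S T : (H →L[ℂ] H) →ₗ[ℂ] (H →L[ℂ] H)}
    (h : IsTraceTranspose S T) : traceForm ∘ₗ S = T.dualMap ∘ₗ traceForm :=
  LinearMap.ext fun X => LinearMap.ext fun Y => h X Y

theorem IsTraceTranspose.sub_id {S T : (H →L[ℂ] H) →ₗ[ℂ] (H →L[ℂ] H)}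
    (h : IsTraceTranspose S T) : IsTraceTranspose (S - LinearMap.id) (T - LinearMap.id) := by
  intro X Y
  rw [LinearMap.sub_apply, LinearMap.sub_apply, sub_mul, mul_sub, tr_sub, tr_sub, h X Y]
  rfl

variable [FiniteDimensional ℂ H]

theorem traceForm_bijective : Function.Bijective (traceForm (H := H)) := by
  have hinj : Function.Injective (traceForm (H := H)) := fun X Y h =>
    eq_of_forall_tr_mul_eq fun Z => LinearMap.congr_fun h Z
  exact ⟨hinj, (LinearMap.injective_iff_surjective_of_finrank_eq_finrank
    Subspace.dual_finrank_eq.symm).1 hinj⟩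

/-- The trace form identifies `S` with the dual map of `T`, which has the same rank. Applied to `S -
1` and `T - 1`, this compares the dimensions of the two fixed-point spaces. -/
theorem IsTraceTranspose.finrank_ker {S T : (H →L[ℂ] H) →ₗ[ℂ] (H →L[ℂ] H)}
    (h : IsTraceTranspose S T) : Module.finrank ℂ S.ker = Module.finrank ℂ T.ker := by
  have h1 : Module.finrank ℂ S.range = Module.finrank ℂ T.range := by
    rw [← LinearMap.finrank_range_dualMap_eq_finrank_range T,
      ← LinearMap.range_comp_of_range_eq_top T.dualMap
        (LinearMap.range_eq_top.2 (traceForm_bijective (H := H)).2), ← h.traceForm_comp,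
      LinearMap.range_comp]
    exact LinearEquiv.finrank_eq (Submodule.equivMapOfInjective _ traceForm_bijective.1 _)
  have h2 := S.finrank_range_add_finrank_ker
  have h3 := T.finrank_range_add_finrank_ker
  omega

/-- The range of a dual map is the annihilator of the kernel. -/
theorem IsTraceTranspose.mem_range {S T : (H →L[ℂ] H) →ₗ[ℂ] (H →L[ℂ] H)}
    (h : IsTraceTranspose S T) {X : H →L[ℂ] H} (hX : ∀ Y, T Y = 0 → tr (X * Y) = 0) :
    X ∈ S.range := by
  have h1 : traceForm X ∈ T.dualMap.range := by
    rw [LinearMap.range_dualMap_eq_dualAnnihilator_ker, Submodule.mem_dualAnnihilator]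
    exact hX
  obtain ⟨f, hf⟩ := h1
  obtain ⟨Z, rfl⟩ := traceForm_bijective.2 f
  refine ⟨Z, traceForm_bijective.1 ?_⟩
  rw [← hf]
  exact LinearMap.congr_fun h.traceForm_comp Z

end Duality

/-! ### Unital maps at the eigenvalue one -/

section Unital

variable {H : Type*} [NormedAddCommGroup H] [InnerProductSpace ℂ H] [CompleteSpace H]
  {ι : Type*} [Fintype ι]

theorem nonpos_of_forall_nsmul_le {X C : H →L[ℂ] H} (hX : IsSelfAdjoint X)
    (h : ∀ n : ℕ, n • X ≤ C) : X ≤ 0 := by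
  rw [← neg_nonneg, ContinuousLinearMap.nonneg_iff_isPositive, ContinuousLinearMap.isPositive_def']
  refine ⟨hX.neg, fun x => ?_⟩
  by_contra! hx
  rw [ContinuousLinearMap.reApplyInnerSelf_apply, neg_apply, inner_neg_left, map_neg,
    Left.neg_neg_iff] at hx
  obtain ⟨n, hn⟩ := exists_nat_gt (RCLike.re (inner ℂ (C x) x) / RCLike.re (inner ℂ (X x) x))
  rw [div_lt_iff₀ hx] at hn
  have := ((ContinuousLinearMap.le_def _ _).1 (h n)).re_inner_nonneg_left x
  rw [sub_apply, inner_sub_left, map_sub, ← Nat.cast_smul_eq_nsmul ℂ, smul_apply,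
    inner_smul_left, Complex.conj_natCast, sub_nonneg] at this
  refine absurd (hn.trans_le ?_) (lt_irrefl _)
  refine le_trans (le_of_eq ?_) this
  simp

/-- A unital positive map has no nontrivial Jordan block at the eigenvalue `1`. -/
theorem eq_zero_of_krausMap_eq_add {K : ι → H →L[ℂ] H} (h1 : krausMap K 1 = 1) {X Z : H →L[ℂ] H}
    (hX : krausMap K X = X) (hZ : krausMap K Z = Z + X) : X = 0 := by
  have key : ∀ X Z : H →L[ℂ] H, IsSelfAdjoint Z → krausMap K X = X → krausMap K Z = Z + X →
      X ≤ 0 := by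
    intro X Z hZs hX hZ
    have hXs : IsSelfAdjoint X := by
      have e : X = krausMap K Z - Z := by rw [hZ, add_sub_cancel_left]
      rw [e]
      refine IsSelfAdjoint.sub ?_ hZs
      rw [isSelfAdjoint_iff, ← krausMap_star, hZs.star_eq]
    have hmono : ∀ {A B : H →L[ℂ] H}, A ≤ B → krausMap K A ≤ krausMap K B := fun h => by
      rw [← sub_nonneg, ← map_sub]
      exact krausMap_nonneg K (sub_nonneg.2 h)
    have hc : ∀ c : ℝ, krausMap K (algebraMap ℝ (H →L[ℂ] H) c) = algebraMap ℝ (H →L[ℂ] H) c := by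
      intro c
      rw [Algebra.algebraMap_eq_smul_one, ← Complex.coe_smul, map_smul, h1]
    -- `Z + n X` is the `n`-th iterate of `Z`. The bound `Z ≤ ‖Z‖` survives each iteration because
    -- the map is monotone and fixes scalars; growth linear in `n` then forces `X ≤ 0`.
    have hn : ∀ n : ℕ, Z + n • X ≤ algebraMap ℝ (H →L[ℂ] H) ‖Z‖ := by
      intro n
      induction n with
      | zero => simpa using hZs.le_algebraMap_norm_self
      | succ n ih =>
        have := hmono ih
        rw [map_add, hZ, map_nsmul, hX, hc] at this
        rwa [succ_nsmul', ← add_assoc]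
    refine nonpos_of_forall_nsmul_le (C := algebraMap ℝ (H →L[ℂ] H) ‖Z‖ - Z) hXs fun n => ?_
    exact le_sub_iff_add_le'.2 (hn n)
  have key' : ∀ X Z : H →L[ℂ] H, IsSelfAdjoint Z → krausMap K X = X → krausMap K Z = Z + X →
      X = 0 := by
    intro X Z hZs hX hZ
    refine le_antisymm (key X Z hZs hX hZ) (neg_nonpos.1 (key (-X) (-Z) hZs.neg ?_ ?_))
    · rw [map_neg, hX]
    · rw [map_neg, hZ, neg_add]
  have hXs : krausMap K (star X) = star X := by rw [krausMap_star, hX]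
  have hZs : krausMap K (star Z) = star Z + star X := by rw [krausMap_star, hZ, star_add]
  have e1 := key' (X + star X) (Z + star Z) (IsSelfAdjoint.add_star_self Z)
    (by rw [map_add, hX, hXs]) (by rw [map_add, hZ, hZs]; abel)
  have e2 := key' (Complex.I • (X - star X)) (Complex.I • (Z - star Z))
    (by
      rw [isSelfAdjoint_iff, star_smul, star_sub, star_star, Complex.star_def, Complex.conj_I]
      module)
    (by rw [map_smul, map_sub, hX, hXs]) (by rw [map_smul, map_sub, hZ, hZs]; module)
  have e3 := (smul_eq_zero.1 e2).resolve_left Complex.I_ne_zero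
  have e4 : (2 : ℂ) • X = (X + star X) + (X - star X) := by module
  rw [e1, e3, add_zero] at e4
  exact (smul_eq_zero.1 e4).resolve_left two_ne_zero

variable [FiniteDimensional ℂ H]

theorem hsAdjoint_krausMap_eq_krausMap (K : ι → H →L[ℂ] H) :
    hsAdjoint (krausMap K) = krausMap fun i => star (K i) := by
  refine LinearMap.ext fun X => ?_
  rw [hsAdjoint_krausMap, krausMap_apply]
  simp only [star_star]

theorem isTraceTranspose_hsAdjoint_krausMap (K : ι → H →L[ℂ] H) :
    IsTraceTranspose (hsAdjoint (krausMap K)) (krausMap K) := fun X Y => by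
  rw [tr_krausMap_mul, hsAdjoint_krausMap]

theorem finrank_Fix_hsAdjoint (K : ι → H →L[ℂ] H) :
    Module.finrank ℂ (Fix (hsAdjoint (krausMap K))) = Module.finrank ℂ (Fix (krausMap K)) := by
  rw [Fix_eq_ker, Fix_eq_ker]
  exact (isTraceTranspose_hsAdjoint_krausMap K).sub_id.finrank_ker

theorem hsAdjoint_krausMap_one {K : ι → H →L[ℂ] H} (hK : IsTracePreserving (krausMap K)) :
    hsAdjoint (krausMap K) 1 = 1 := by
  rw [hsAdjoint_krausMap]
  simpa using (isTracePreserving_krausMap_iff K).1 hK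

/-- A fixed point of the dual channel that annihilates all fixed points of the channel is `0`. -/
theorem eq_zero_of_mem_Fix_hsAdjoint {K : ι → H →L[ℂ] H} (hK : IsTracePreserving (krausMap K))
    {X : H →L[ℂ] H} (hX : X ∈ Fix (hsAdjoint (krausMap K)))
    (h : ∀ Y ∈ Fix (krausMap K), tr (X * Y) = 0) : X = 0 := by
  obtain ⟨Z, hZ⟩ := (isTraceTranspose_hsAdjoint_krausMap K).sub_id.mem_range (X := X) fun Y hY =>
    h Y (sub_eq_zero.1 hY)
  have h1 := hsAdjoint_krausMap_one hK
  rw [mem_Fix] at hX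
  rw [LinearMap.sub_apply, LinearMap.id_apply, sub_eq_iff_eq_add'] at hZ
  rw [hsAdjoint_krausMap_eq_krausMap] at hX hZ h1
  exact eq_zero_of_krausMap_eq_add h1 hX hZ

end Unital

/-! ### Channels with a faithful fixed point -/

section Faithful

variable {H : Type*} [NormedAddCommGroup H] [InnerProductSpace ℂ H] [CompleteSpace H]
  {ι : Type*} [Fintype ι]

theorem krausMap_mul_left {K : ι → H →L[ℂ] H} {a : H →L[ℂ] H}
    (ha : a ∈ StarSubalgebra.centralizer ℂ (Set.range K)) (X : H →L[ℂ] H) :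
    krausMap K (a * X) = a * krausMap K X := by
  rw [StarSubalgebra.mem_centralizer_iff] at ha
  simp only [krausMap_apply, Finset.mul_sum]
  refine Finset.sum_congr rfl fun i _ => ?_
  rw [← mul_assoc, (ha _ ⟨i, rfl⟩).1, mul_assoc, mul_assoc, mul_assoc]

theorem krausMap_mul_right {K : ι → H →L[ℂ] H} {a : H →L[ℂ] H}
    (ha : a ∈ StarSubalgebra.centralizer ℂ (Set.range K)) (X : H →L[ℂ] H) :
    krausMap K (X * a) = krausMap K X * a := by
  rw [StarSubalgebra.mem_centralizer_iff] at ha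
  simp only [krausMap_apply, Finset.sum_mul]
  refine Finset.sum_congr rfl fun i _ => ?_
  rw [mul_assoc (K i * X), (ha _ ⟨i, rfl⟩).2, ← mul_assoc, ← mul_assoc]

variable [FiniteDimensional ℂ H]

/-- The fixed points of the dual of a channel with a faithful invariant state are the operators
that commute with all Kraus operators and their adjoints. -/
theorem Fix_hsAdjoint_eq_centralizer {K : ι → H →L[ℂ] H} (hK : IsTracePreserving (krausMap K))
    {ρ : H →L[ℂ] H} (hρ : 0 ≤ ρ) (hfix : ρ ∈ Fix (krausMap K)) (hinj : ∀ x, ρ x = 0 → x = 0) :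
    (Fix (hsAdjoint (krausMap K)) : Set (H →L[ℂ] H)) =
      StarSubalgebra.centralizer ℂ (Set.range K) := by
  have hK1 := (isTracePreserving_krausMap_iff K).1 hK
  have key : ∀ X, (∑ i, star (K i) * X * K i) = X → ∀ i, K i * X = X * K i := by
    intro X hX
    have hXs : (∑ i, star (K i) * star X * K i) = star X := by
      conv_rhs => rw [← hX]
      simp [mul_assoc]
    -- The sum of the `C i† C i` measures the failure of multiplicativity of the dual channel at `X†
    -- X`. Its expectation in the fixed point `ρ` is zero.
    let C : ι → H →L[ℂ] H := fun i => K i * X - X * K i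
    have hC : ∑ i, star (C i) * C i = (∑ i, star (K i) * (star X * X) * K i) - star X * X := by
      have e : ∀ i, star (C i) * C i = star X * (star (K i) * K i) * X -
          star X * (star (K i) * X * K i) - (star (K i) * star X * K i) * X +
          star (K i) * (star X * X) * K i := by
        intro i
        simp only [C, star_sub, star_mul]
        noncomm_ring
      simp only [e, Finset.sum_add_distrib, Finset.sum_sub_distrib, ← Finset.mul_sum,
        ← Finset.sum_mul, hK1, hX, hXs, mul_one]
      abel
    have ht : ∑ i, tr (C i * ρ * star (C i)) = 0 := by
      have e : ∀ i, tr (C i * ρ * star (C i)) = tr (star (C i) * C i * ρ) := fun i => by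
        rw [tr_mul_comm, mul_assoc]
      simp only [e]
      rw [← tr_sum, ← Finset.sum_mul, hC, sub_mul, tr_sub, ← tr_krausMap_mul, mem_Fix.1 hfix,
        sub_self]
    have hnn : ∀ i, 0 ≤ C i * ρ * star (C i) := fun i => star_right_conjugate_nonneg hρ _
    have h0 := (Finset.sum_eq_zero_iff_of_nonneg fun i _ => tr_nonneg (hnn i)).1 ht
    intro i
    have hi := eq_zero_of_tr_eq_zero (hnn i) (h0 i (Finset.mem_univ i))
    have hCs : star (C i) = 0 := by
      ext x
      refine hinj _ (apply_eq_zero_of_inner_eq_zero hρ ?_)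
      rw [ContinuousLinearMap.star_eq_adjoint, ContinuousLinearMap.adjoint_inner_left]
      have := congrArg (fun Z : H →L[ℂ] H => inner ℂ x (Z x)) hi
      simpa [ContinuousLinearMap.star_eq_adjoint] using this
    exact sub_eq_zero.1 (star_eq_zero.1 hCs)
  ext X
  rw [SetLike.mem_coe, mem_Fix, hsAdjoint_krausMap, SetLike.mem_coe,
    StarSubalgebra.mem_centralizer_iff]
  constructor
  · rintro hX _ ⟨i, rfl⟩
    refine ⟨key X hX i, ?_⟩
    -- Commutation with `(K i)†` follows by applying `key` to `X†`, which is also fixed.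
    have hXs : (∑ i, star (K i) * star X * K i) = star X := by
      conv_rhs => rw [← hX]
      simp [mul_assoc]
    simpa using (congrArg star (key _ hXs i)).symm
  · intro hX
    have e : ∀ i, star (K i) * X * K i = star (K i) * K i * X := fun i => by
      rw [mul_assoc, ← (hX _ ⟨i, rfl⟩).1, mul_assoc]
    simp only [e, ← Finset.sum_mul, hK1, one_mul]

end Faithful

/-! ### Restriction to the support -/

section Restriction

variable {H : Type*} [NormedAddCommGroup H] [InnerProductSpace ℂ H] [FiniteDimensional ℂ H]
  (P : Submodule ℂ H)

theorem sandwich_eq_embed_compress (X : H →L[ℂ] H) : sandwich P X = embed P (compress P X) := rfl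

theorem compress_embed (X : P →L[ℂ] P) : compress P (embed P X) = X := by
  ext x
  simp [compress, embed]

theorem embed_injective : Function.Injective (embed P) :=
  Function.LeftInverse.injective (compress_embed P)

theorem embed_apply_coe (X : P →L[ℂ] P) (x : P) : embed P X x = X x := by
  simp [embed]

theorem compress_mul {X Y : H →L[ℂ] H} (hY : ∀ x ∈ P, Y x ∈ P) :
    compress P (X * Y) = compress P X * compress P Y := by
  ext x
  simp [compress, Submodule.starProjection_eq_self_iff.2 (hY x x.2)]

theorem compress_one : compress P 1 = 1 := by
  ext x
  simp [compress]

theorem compress_nonneg {X : H →L[ℂ] H} (hX : 0 ≤ X) : 0 ≤ compress P X := by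
  rw [ContinuousLinearMap.nonneg_iff_isPositive] at hX ⊢
  exact hX.orthogonalProjectionOnto_comp P

theorem Fix_eq_map_embed {P : Submodule ℂ H} {T : (H →L[ℂ] H) →ₗ[ℂ] (H →L[ℂ] H)} (hT : IsInvariantSubspace T P)
    (hP : ∀ X ∈ Fix T, sandwich P X = X) : Fix T = (Fix (restrict T P)).map (embed P) := by
  ext X
  constructor
  · intro hX
    have h := hP X hX
    refine ⟨compress P X, ?_, h⟩
    change compress P (T (embed P (compress P X))) = compress P X
    rw [← sandwich_eq_embed_compress, h, mem_Fix.1 hX]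
  · rintro ⟨x, hx, rfl⟩
    have h := hT (embed P x) (by rw [sandwich_eq_embed_compress, compress_embed])
    rw [mem_Fix, ← h, sandwich_eq_embed_compress]
    exact congrArg (embed P) hx

variable [CompleteSpace H]

theorem star_compress (X : H →L[ℂ] H) : star (compress P X) = compress P (star X) := by
  simp [compress, ContinuousLinearMap.star_eq_adjoint, ContinuousLinearMap.adjoint_comp,
    Submodule.adjoint_subtypeL, Submodule.adjoint_orthogonalProjectionOnto,
    ContinuousLinearMap.comp_assoc]

variable {P} {ι : Type*} [Fintype ι]

theorem sandwich_eq_self_of_range_le {X : H →L[ℂ] H} (h1 : (X : H →ₗ[ℂ] H).range ≤ P)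
    (h2 : (X.adjoint : H →ₗ[ℂ] H).range ≤ P) : sandwich P X = X := by
  have e1 : P.starProjection * X = X := by
    ext x
    exact Submodule.starProjection_eq_self_iff.2 (h1 ⟨x, rfl⟩)
  have e2 : P.starProjection * star X = star X := by
    ext x
    exact Submodule.starProjection_eq_self_iff.2 (h2 ⟨x, rfl⟩)
  have e3 : X * P.starProjection = X := by
    have := congrArg star e2
    rwa [star_mul, star_star, isStarProjection_starProjection.isSelfAdjoint.star_eq] at this
  change P.starProjection * (X * P.starProjection) = X
  rw [e3, e1]

theorem sandwich_eq_self_of_mem {S : Set (H →L[ℂ] H)} {X : H →L[ℂ] H} (hX : X ∈ S) :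
    sandwich (support S) X = X :=
  sandwich_eq_self_of_range_le (le_sup_left.trans (le_iSup₂_of_le X hX le_rfl))
    (le_sup_right.trans (le_iSup₂_of_le X hX le_rfl))

/-- Each term `Kᵢ ρ Kᵢ†` is dominated by their sum `ρ`, so it vanishes on `ker ρ`. Thus `Kᵢ†`
preserves `ker ρ` and `Kᵢ` preserves its orthogonal complement. -/
theorem mapsTo_range_of_mem_Fix {K : ι → H →L[ℂ] H} {ρ : H →L[ℂ] H} (hρ : 0 ≤ ρ)
    (hfix : ρ ∈ Fix (krausMap K)) (hP : (ρ : H →ₗ[ℂ] H).range = P) (i : ι) :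
    ∀ x ∈ P, K i x ∈ P := by
  have hker : ∀ y, ρ y = 0 → ρ (star (K i) y) = 0 := by
    intro y hy
    have hle : K i * ρ * star (K i) ≤ ρ := by
      conv_rhs => rw [← mem_Fix.1 hfix, krausMap_apply]
      exact Finset.single_le_sum (f := fun i => K i * ρ * star (K i))
        (fun j _ => star_right_conjugate_nonneg hρ (K j)) (Finset.mem_univ i)
    have h0 := apply_eq_zero_of_le (star_right_conjugate_nonneg hρ (K i)) hle hy
    refine apply_eq_zero_of_inner_eq_zero hρ ?_
    rw [ContinuousLinearMap.star_eq_adjoint, ContinuousLinearMap.adjoint_inner_left]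
    have := congrArg (fun z => inner ℂ y z) h0
    simpa [ContinuousLinearMap.star_eq_adjoint] using this
  have hPk : P = (ρ : H →ₗ[ℂ] H).kerᗮ := by
    rw [← hP, range_eq_orthogonal_ker (IsSelfAdjoint.of_nonneg hρ)]
  rw [hPk]
  intro x hx y hy
  rw [← ContinuousLinearMap.adjoint_inner_left]
  exact hx _ (hker y hy)

theorem isInvariantSubspace_krausMap {K : ι → H →L[ℂ] H} (hK : ∀ i, ∀ x ∈ P, K i x ∈ P) :
    IsInvariantSubspace (krausMap K) P := by
  intro X hX
  have h1 : ∀ i, P.starProjection * K i * P.starProjection = K i * P.starProjection := fun i => by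
    ext x
    exact Submodule.starProjection_eq_self_iff.2
      (hK i _ (Submodule.starProjection_apply_mem P x))
  have h2 : ∀ i, P.starProjection * star (K i) * P.starProjection =
      P.starProjection * star (K i) := fun i => by
    have := congrArg star (h1 i)
    simpa [isStarProjection_starProjection.isSelfAdjoint.star_eq, mul_assoc] using this
  change P.starProjection * (krausMap K X * P.starProjection) = krausMap K X
  change P.starProjection * (X * P.starProjection) = X at hX
  rw [← hX, krausMap_apply, Finset.sum_mul, Finset.mul_sum]
  refine Finset.sum_congr rfl fun i _ => ?_
  have e : P.starProjection * (K i * (P.starProjection * (X * P.starProjection)) * star (K i) *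
      P.starProjection) = (P.starProjection * K i * P.starProjection) * X *
      (P.starProjection * star (K i) * P.starProjection) := by
    simp only [mul_assoc]
  rw [e, h1, h2]
  simp only [mul_assoc]

theorem restrict_krausMap (K : ι → H →L[ℂ] H) :
    restrict (krausMap K) P = krausMap fun i => compress P (K i) := by
  refine LinearMap.ext fun X => ?_
  change compress P (krausMap K (embed P X)) = _
  rw [krausMap_apply, map_sum, krausMap_apply]
  refine Finset.sum_congr rfl fun i _ => ?_
  rw [star_compress]
  ext x
  simp [compress, embed]

theorem isTracePreserving_krausMap_compress {K : ι → H →L[ℂ] H} (hK : ∀ i, ∀ x ∈ P, K i x ∈ P)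
    (hTP : IsTracePreserving (krausMap K)) :
    IsTracePreserving (krausMap fun i => compress P (K i)) := by
  rw [isTracePreserving_krausMap_iff] at hTP ⊢
  have e : ∀ i, star (compress P (K i)) * compress P (K i) = compress P (star (K i) * K i) :=
    fun i => by rw [star_compress, compress_mul P (hK i)]
  simp only [e]
  rw [← map_sum, hTP, compress_one]

/-- The compression maps the fixed points of the dual channel to those of the dual of the
restricted channel. -/
theorem compress_mem_Fix_hsAdjoint {K : ι → H →L[ℂ] H} (hK : ∀ i, ∀ x ∈ P, K i x ∈ P)
    {X : H →L[ℂ] H} (hX : X ∈ Fix (hsAdjoint (krausMap K))) :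
    compress P X ∈ Fix (hsAdjoint (krausMap fun i => compress P (K i))) := by
  rw [mem_Fix, hsAdjoint_krausMap] at hX ⊢
  conv_rhs => rw [← hX, map_sum]
  refine Finset.sum_congr rfl fun i _ => ?_
  rw [star_compress, compress_mul P (hK i)]
  congr 1
  ext x
  -- The part of `X x` outside `P` stays outside `P` under `(K i)†`, so compression removes it.
  have h : ∀ y ∈ Pᗮ, star (K i) y ∈ Pᗮ := fun y hy z hz => by
    rw [ContinuousLinearMap.star_eq_adjoint, ContinuousLinearMap.adjoint_inner_right]
    exact hy _ (hK i z hz)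
  have h' : P.starProjection (star (K i) (X x - P.starProjection (X x))) = 0 :=
    (Submodule.starProjection_apply_eq_zero_iff _).2 (h _ (P.sub_starProjection_mem_orthogonal _))
  rw [map_sub, map_sub, sub_eq_zero] at h'
  exact h'.symm

/-- Compression is injective on the fixed points of the dual: a difference with zero compression
annihilates every fixed `Z = P Z P`. All four fixed-point spaces involved have the same dimension,
so the inclusion is an equality. -/
theorem map_compress_Fix_hsAdjoint {K : ι → H →L[ℂ] H} (hTP : IsTracePreserving (krausMap K))
    (hK : ∀ i, ∀ x ∈ P, K i x ∈ P) (hP : ∀ X ∈ Fix (krausMap K), sandwich P X = X) :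
    (Fix (hsAdjoint (krausMap K))).map (compress P) =
      Fix (hsAdjoint (krausMap fun i => compress P (K i))) := by
  refine Submodule.eq_of_le_of_finrank_eq ?_ ?_
  · rintro _ ⟨X, hX, rfl⟩
    exact compress_mem_Fix_hsAdjoint hK hX
  have hinj : Set.InjOn (compress P) (Fix (hsAdjoint (krausMap K))) := by
    intro X hX Y hY h
    rw [← sub_eq_zero]
    refine eq_zero_of_mem_Fix_hsAdjoint hTP (sub_mem hX hY) fun Z hZ => ?_
    have h0 : sandwich P (X - Y) = 0 := by
      rw [sandwich_eq_embed_compress, map_sub, h, sub_self, map_zero]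
    rw [← hP Z hZ]
    change tr ((X - Y) * (P.starProjection * (Z * P.starProjection))) = 0
    rw [← mul_assoc, ← mul_assoc, tr_mul_comm, ← mul_assoc, ← mul_assoc]
    change tr ((P.starProjection * (X - Y) * P.starProjection) * Z) = 0
    rw [mul_assoc P.starProjection]
    change tr (sandwich P (X - Y) * Z) = 0
    rw [h0, zero_mul]
    simp [tr]
  have e1 : Module.finrank ℂ ((Fix (hsAdjoint (krausMap K))).map (compress P)) =
      Module.finrank ℂ (Fix (hsAdjoint (krausMap K))) := by
    rw [← LinearMap.range_domRestrict]
    exact LinearMap.finrank_range_of_inj fun X Y h => Subtype.ext (hinj X.2 Y.2 h)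
  have e2 : Module.finrank ℂ (Fix (krausMap K)) =
      Module.finrank ℂ (Fix (krausMap fun i => compress P (K i))) := by
    rw [Fix_eq_map_embed (isInvariantSubspace_krausMap hK) hP, restrict_krausMap]
    exact (LinearEquiv.finrank_eq (Submodule.equivMapOfInjective _ (embed_injective P) _)).symm
  rw [e1, finrank_Fix_hsAdjoint, finrank_Fix_hsAdjoint, e2]

end Restriction

/-! ### Algebra of block operators -/

namespace SectorDecomposition

variable {K : Type*} [NormedAddCommGroup K] [InnerProductSpace ℂ K] (σ : SectorDecomposition K)

/-- The orthonormal basis adapted to a sector decomposition. -/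
def basis : OrthonormalBasis (Σ k : Fin σ.sectors, Fin (σ.d k) × Fin (σ.n k)) ℂ K :=
  OrthonormalBasis.ofRepr σ.U

/-- The matrix unit `|x⟩⟨y|` of the adapted basis. -/
abbrev unit (x y : Σ k : Fin σ.sectors, Fin (σ.d k) × Fin (σ.n k)) : K →L[ℂ] K :=
  InnerProductSpace.rankOne ℂ (σ.basis x) (σ.basis y)

theorem inner_op (M : ∀ k, Matrix (Fin (σ.d k)) (Fin (σ.d k)) ℂ)
    (N : ∀ k, Matrix (Fin (σ.n k)) (Fin (σ.n k)) ℂ)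
    (x y : Σ k : Fin σ.sectors, Fin (σ.d k) × Fin (σ.n k)) :
    inner ℂ (σ.basis x) (σ.op M N (σ.basis y)) =
      Matrix.blockDiagonal' (fun k => M k ⊗ₖ N k) x y := by
  rw [← σ.basis.repr_apply_apply]
  change (σ.U (σ.U.symm (Matrix.toEuclideanCLM (𝕜 := ℂ) (Matrix.blockDiagonal' fun k => M k ⊗ₖ N k)
    (σ.U (σ.basis y))))) x = _
  have h : σ.U (σ.basis y) = EuclideanSpace.single y 1 := σ.basis.repr_self y
  rw [σ.U.apply_symm_apply, h, Matrix.ofLp_toEuclideanCLM]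
  simp

theorem op_eq_sum_unit (M : ∀ k, Matrix (Fin (σ.d k)) (Fin (σ.d k)) ℂ)
    (N : ∀ k, Matrix (Fin (σ.n k)) (Fin (σ.n k)) ℂ) :
    σ.op M N = ∑ k, ∑ a, ∑ b, ∑ a', ∑ b',
      (M k a a' * N k b b') • σ.unit ⟨k, a, b⟩ ⟨k, a', b'⟩ := by
  rw [op_eq_sum_rankOne σ.basis (σ.op M N)]
  simp only [inner_op, Fintype.sum_sigma, Fintype.sum_prod_type]
  refine Finset.sum_congr rfl fun k _ => Finset.sum_congr rfl fun a _ =>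
    Finset.sum_congr rfl fun b _ => ?_
  rw [Finset.sum_eq_single k]
  · simp only [Matrix.blockDiagonal'_apply_eq, Matrix.kroneckerMap_apply]
  · intro k' _ hk
    simp [Matrix.blockDiagonal'_apply_ne _ _ _ hk.symm]
  · simp

theorem op_mul (M M' : ∀ k, Matrix (Fin (σ.d k)) (Fin (σ.d k)) ℂ)
    (N N' : ∀ k, Matrix (Fin (σ.n k)) (Fin (σ.n k)) ℂ) :
    σ.op M N * σ.op M' N' = σ.op (fun k => M k * M' k) fun k => N k * N' k := by
  have h : Matrix.blockDiagonal' (fun k => (M k * M' k) ⊗ₖ (N k * N' k)) =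
      Matrix.blockDiagonal' (fun k => M k ⊗ₖ N k) * Matrix.blockDiagonal' fun k => M' k ⊗ₖ N' k := by
    rw [← Matrix.blockDiagonal'_mul]
    simp only [Matrix.mul_kronecker_mul]
  ext x
  simp [op, h]

theorem op_one_one : σ.op 1 1 = 1 := by
  have h : Matrix.blockDiagonal' (fun k => (1 : Matrix (Fin (σ.d k)) (Fin (σ.d k)) ℂ) ⊗ₖ
      (1 : Matrix (Fin (σ.n k)) (Fin (σ.n k)) ℂ)) = 1 := by
    simp only [Matrix.one_kronecker_one]
    exact Matrix.blockDiagonal'_one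
  ext x
  change σ.U.symm (Matrix.toEuclideanCLM (𝕜 := ℂ) (Matrix.blockDiagonal' fun k =>
    (1 : Matrix (Fin (σ.d k)) (Fin (σ.d k)) ℂ) ⊗ₖ (1 : Matrix (Fin (σ.n k)) (Fin (σ.n k)) ℂ))
    (σ.U x)) = x
  rw [h, map_one, one_apply_eq_self, σ.U.symm_apply_apply]

theorem op_add_left (M M' : ∀ k, Matrix (Fin (σ.d k)) (Fin (σ.d k)) ℂ)
    (N : ∀ k, Matrix (Fin (σ.n k)) (Fin (σ.n k)) ℂ) :
    σ.op (M + M') N = σ.op M N + σ.op M' N := by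
  simp only [op_eq_sum_unit, Pi.add_apply, Matrix.add_apply, add_mul, add_smul,
    Finset.sum_add_distrib]

theorem op_smul_left (c : ℂ) (M : ∀ k, Matrix (Fin (σ.d k)) (Fin (σ.d k)) ℂ)
    (N : ∀ k, Matrix (Fin (σ.n k)) (Fin (σ.n k)) ℂ) : σ.op (c • M) N = c • σ.op M N := by
  simp only [op_eq_sum_unit, Pi.smul_apply, Matrix.smul_apply, smul_eq_mul, mul_assoc, mul_smul,
    Finset.smul_sum]

/-- `M ↦ ⨁ₖ M k ⊗ N k` as a linear map. -/
def opLin (N : ∀ k, Matrix (Fin (σ.n k)) (Fin (σ.n k)) ℂ) :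
    (∀ k, Matrix (Fin (σ.d k)) (Fin (σ.d k)) ℂ) →ₗ[ℂ] (K →L[ℂ] K) where
  toFun M := σ.op M N
  map_add' M M' := σ.op_add_left M M' N
  map_smul' c M := σ.op_smul_left c M N

theorem coe_range_opLin (N : ∀ k, Matrix (Fin (σ.n k)) (Fin (σ.n k)) ℂ) :
    ((σ.opLin N).range : Set (K →L[ℂ] K)) = σ.blockSet N := rfl

theorem opLin_injective {N : ∀ k, Matrix (Fin (σ.n k)) (Fin (σ.n k)) ℂ} (hN : ∀ k, N k ≠ 0) :
    Function.Injective (σ.opLin N) := by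
  intro M M' h
  funext k
  obtain ⟨b, b', hb⟩ : ∃ b b', N k b b' ≠ 0 := by
    by_contra! h0
    exact hN k (Matrix.ext h0)
  ext a a'
  have := congrArg (fun X : K →L[ℂ] K => inner ℂ (σ.basis ⟨k, a, b⟩) (X (σ.basis ⟨k, a', b'⟩))) h
  change inner ℂ _ (σ.op M N _) = inner ℂ _ (σ.op M' N _) at this
  rw [inner_op, inner_op, Matrix.blockDiagonal'_apply_eq, Matrix.blockDiagonal'_apply_eq,
    Matrix.kroneckerMap_apply, Matrix.kroneckerMap_apply] at this
  exact mul_right_cancel₀ hb this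

theorem op_smul_right (c : ∀ _ : Fin σ.sectors, ℂ) (M : ∀ k, Matrix (Fin (σ.d k)) (Fin (σ.d k)) ℂ)
    (N : ∀ k, Matrix (Fin (σ.n k)) (Fin (σ.n k)) ℂ) :
    σ.op M (fun k => c k • N k) = σ.op (fun k => c k • M k) N := by
  simp only [op, Matrix.kronecker_smul, Matrix.smul_kronecker]

/-- The operator `m ⊗ N` in the sector `k`. -/
theorem op_single (k : Fin σ.sectors) (m : Matrix (Fin (σ.d k)) (Fin (σ.d k)) ℂ)
    (N : ∀ k, Matrix (Fin (σ.n k)) (Fin (σ.n k)) ℂ) :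
    σ.op (Pi.single k m) N = ∑ a, ∑ b, ∑ a', ∑ b',
      (m a a' * N k b b') • σ.unit ⟨k, a, b⟩ ⟨k, a', b'⟩ := by
  rw [op_eq_sum_unit, Finset.sum_eq_single k]
  · simp
  · intro k' _ hk
    simp [Pi.single_eq_of_ne hk]
  · simp

theorem sum_op_single (M : ∀ k, Matrix (Fin (σ.d k)) (Fin (σ.d k)) ℂ)
    (N : ∀ k, Matrix (Fin (σ.n k)) (Fin (σ.n k)) ℂ) :
    ∑ k, σ.op (Pi.single k (M k)) N = σ.op M N := by
  simp only [op_single]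
  rw [op_eq_sum_unit]

theorem op_single_congr (k : Fin σ.sectors) (m : Matrix (Fin (σ.d k)) (Fin (σ.d k)) ℂ)
    {N N' : ∀ k, Matrix (Fin (σ.n k)) (Fin (σ.n k)) ℂ} (h : N k = N' k) :
    σ.op (Pi.single k m) N = σ.op (Pi.single k m) N' := by
  rw [op_single, op_single, h]

theorem sum_op_right {ι : Type*} (s : Finset ι) (M : ∀ k, Matrix (Fin (σ.d k)) (Fin (σ.d k)) ℂ)
    (N : ι → ∀ k, Matrix (Fin (σ.n k)) (Fin (σ.n k)) ℂ) :
    ∑ i ∈ s, σ.op M (N i) = σ.op M fun k => ∑ i ∈ s, N i k := by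
  have h0 : σ.op M 0 = 0 := by simp [op_eq_sum_unit]
  have hadd : ∀ N N', σ.op M (N + N') = σ.op M N + σ.op M N' := fun N N' => by
    simp only [op_eq_sum_unit, Pi.add_apply, Matrix.add_apply, mul_add, add_smul,
      Finset.sum_add_distrib]
  have := map_sum (⟨⟨σ.op M, h0⟩, hadd⟩ : _ →+ (K →L[ℂ] K)) N s
  refine this.symm.trans (congrArg (σ.op M) ?_)
  funext k
  rw [Finset.sum_apply]

variable [CompleteSpace K]

theorem star_op (M : ∀ k, Matrix (Fin (σ.d k)) (Fin (σ.d k)) ℂ)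
    (N : ∀ k, Matrix (Fin (σ.n k)) (Fin (σ.n k)) ℂ) :
    star (σ.op M N) = σ.op (fun k => star (M k)) fun k => star (N k) := by
  have h : Matrix.blockDiagonal' (fun k => star (M k) ⊗ₖ star (N k)) =
      star (Matrix.blockDiagonal' fun k => M k ⊗ₖ N k) := by
    rw [Matrix.star_eq_conjTranspose, Matrix.blockDiagonal'_conjTranspose]
    simp only [Matrix.conjTranspose_kronecker, Matrix.star_eq_conjTranspose]
  rw [op_eq_sum_rankOne σ.basis (star _), op_eq_sum_rankOne σ.basis (σ.op (fun k => star (M k)) _)]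
  refine Finset.sum_congr rfl fun x _ => Finset.sum_congr rfl fun y _ => ?_
  rw [inner_op, h, ContinuousLinearMap.star_eq_adjoint, ContinuousLinearMap.adjoint_inner_right,
    ← inner_conj_symm, inner_op, Matrix.star_apply, RCLike.star_def]

end SectorDecomposition

/-! ### Reducing subspaces and Schur's lemma -/

section Reducing

variable {K : Type*} [NormedAddCommGroup K] [InnerProductSpace ℂ K] [CompleteSpace K]
  (s : Set (K →L[ℂ] K))

/-- `V` is invariant under all members of `s` and their adjoints. -/
def IsReducing (V : Submodule ℂ K) : Prop :=
  ∀ g ∈ s ∪ star s, ∀ x ∈ V, g x ∈ V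

/-- `V` is minimal among the nonzero subspaces that reduce `s`. -/
def IsMinimalReducing (V : Submodule ℂ K) : Prop :=
  Minimal (fun W => IsReducing s W ∧ W ≠ ⊥) V

variable {s}

theorem mem_centralizer_iff' {a : K →L[ℂ] K} :
    a ∈ StarSubalgebra.centralizer ℂ s ↔ ∀ g ∈ s ∪ star s, g * a = a * g := by
  rw [← SetLike.mem_coe, StarSubalgebra.coe_centralizer, Set.mem_centralizer_iff]

theorem star_mem_union_star {g : K →L[ℂ] K} (hg : g ∈ s ∪ star s) : star g ∈ s ∪ star s :=
  hg.elim (fun h => Or.inr (by simpa using h)) fun h => Or.inl h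

theorem IsReducing.orthogonal {V : Submodule ℂ K} (hV : IsReducing s V) : IsReducing s Vᗮ := by
  intro g hg x hx y hy
  rw [← ContinuousLinearMap.adjoint_inner_left]
  exact hx _ (hV _ (star_mem_union_star hg) y hy)

theorem IsReducing.inf {V W : Submodule ℂ K} (hV : IsReducing s V) (hW : IsReducing s W) :
    IsReducing s (V ⊓ W) := fun g hg x hx => ⟨hV g hg x hx.1, hW g hg x hx.2⟩

theorem isReducing_sSup {c : Set (Submodule ℂ K)} (hc : ∀ V ∈ c, IsReducing s V) :
    IsReducing s (sSup c) := by
  intro g hg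
  have h : sSup c ≤ (sSup c).comap (g : K →ₗ[ℂ] K) :=
    sSup_le fun V hV x hx => le_sSup hV (hc V hV g hg x hx)
  exact fun x hx => h hx

theorem isReducing_ker {a : K →L[ℂ] K} (ha : a ∈ StarSubalgebra.centralizer ℂ s) :
    IsReducing s (a : K →ₗ[ℂ] K).ker := by
  intro g hg x hx
  have h := congrArg (fun b : K →L[ℂ] K => b x) (mem_centralizer_iff'.1 ha g hg)
  have hx' : a x = 0 := hx
  change a (g x) = 0
  change g (a x) = a (g x) at h
  rw [← h, hx', map_zero]

/-- Expanding `(u p - u)† (u p - u)` with `u† u = p` gives zero. -/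
theorem eq_mul_of_star_mul_self_eq {u p : K →L[ℂ] K} (hp : IsStarProjection p)
    (h : star u * u = p) : u * p = u := by
  rw [← sub_eq_zero, ← CStarRing.star_mul_self_eq_zero_iff, star_sub, star_mul,
    hp.isSelfAdjoint.star_eq]
  have e : (p * star u - star u) * (u * p - u) = p * (star u * u) * p - p * (star u * u) -
      (star u * u) * p + star u * u := by noncomm_ring
  rw [e, h, hp.isIdempotentElem.eq, hp.isIdempotentElem.eq, sub_self, zero_sub, neg_add_cancel]

variable [FiniteDimensional ℂ K]

theorem IsReducing.starProjection_mem {V : Submodule ℂ K} (hV : IsReducing s V) :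
    V.starProjection ∈ StarSubalgebra.centralizer ℂ s := by
  refine mem_centralizer_iff'.2 fun g hg => ?_
  ext x
  have h1 := Submodule.starProjection_eq_self_iff.2
    (hV g hg _ (Submodule.starProjection_apply_mem V x))
  have h2 := (Submodule.starProjection_apply_eq_zero_iff _).2
    (hV.orthogonal g hg _ (V.sub_starProjection_mem_orthogonal x))
  rw [map_sub, map_sub, h1, sub_eq_zero] at h2
  exact h2.symm

theorem exists_isMinimalReducing_le {W : Submodule ℂ K} (hW : IsReducing s W) (h0 : W ≠ ⊥) :
    ∃ V ≤ W, IsMinimalReducing s V :=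
  exists_minimal_le_of_wellFoundedLT (fun W => IsReducing s W ∧ W ≠ ⊥) W ⟨hW, h0⟩

/-- Schur's lemma for an operator of the commutant that preserves a minimal reducing subspace. -/
theorem IsMinimalReducing.exists_smul {V : Submodule ℂ K} (hV : IsMinimalReducing s V)
    {a : K →L[ℂ] K} (ha : a ∈ StarSubalgebra.centralizer ℂ s) (hmap : ∀ x ∈ V, a x ∈ V) :
    ∃ c : ℂ, ∀ x ∈ V, a x = c • x := by
  have : Nontrivial V := Submodule.nontrivial_iff_ne_bot.2 hV.prop.2
  obtain ⟨c, hc⟩ := Module.End.exists_eigenvalue ((a : K →ₗ[ℂ] K).restrict hmap)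
  obtain ⟨v, hv⟩ := hc.exists_hasEigenvector
  have hv1 : a v = c • (v : K) := congrArg Subtype.val hv.apply_eq_smul
  have hac : a - algebraMap ℂ _ c ∈ StarSubalgebra.centralizer ℂ s :=
    sub_mem ha (StarSubalgebra.algebraMap_mem _ c)
  -- The eigenspace of `a` inside `V` is a nonzero reducing subspace, so by minimality it is all of
  -- `V`.
  have hle := hV.2 (y := V ⊓ ((a - algebraMap ℂ _ c : K →L[ℂ] K) : K →ₗ[ℂ] K).ker)
    ⟨hV.prop.1.inf (isReducing_ker hac), fun h => hv.2 ?_⟩ inf_le_left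
  · refine ⟨c, fun x hx => ?_⟩
    have h : (a - algebraMap ℂ _ c : K →L[ℂ] K) x = 0 := (hle hx).2
    rw [sub_apply, Algebra.algebraMap_eq_smul_one, sub_eq_zero] at h
    simpa using h
  · have : (v : K) ∈ V ⊓ ((a - algebraMap ℂ _ c : K →L[ℂ] K) : K →ₗ[ℂ] K).ker := by
      refine ⟨v.2, ?_⟩
      change (a - algebraMap ℂ _ c : K →L[ℂ] K) v = 0
      rw [sub_apply, hv1, Algebra.algebraMap_eq_smul_one]
      simp
    rw [h] at this
    exact Subtype.ext this

variable (s) in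
/-- The space is an orthogonal sum of minimal reducing subspaces. -/
theorem exists_orthogonal_isMinimalReducing : ∃ c : Set (Submodule ℂ K),
    (∀ V ∈ c, IsMinimalReducing s V) ∧ (∀ V ∈ c, ∀ W ∈ c, V ≠ W → V ⟂ W) ∧ sSup c = ⊤ := by
  obtain ⟨c, hc⟩ := zorn_subset {c : Set (Submodule ℂ K) |
    (∀ V ∈ c, IsMinimalReducing s V) ∧ ∀ V ∈ c, ∀ W ∈ c, V ≠ W → V ⟂ W} (by
    intro C hC hchain
    refine ⟨⋃₀ C, ⟨?_, ?_⟩, fun c hc => Set.subset_sUnion_of_mem hc⟩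
    · rintro V ⟨c, hc, hV⟩
      exact (hC hc).1 V hV
    · rintro V ⟨c, hc, hV⟩ W ⟨c', hc', hW⟩ hne
      rcases hchain.total hc hc' with h | h
      · exact (hC hc').2 V (h hV) W hW hne
      · exact (hC hc).2 V hV W (h hW) hne)
  refine ⟨c, hc.prop.1, hc.prop.2, ?_⟩
  by_contra htop
  have hred : IsReducing s (sSup c) := isReducing_sSup fun V hV => (hc.prop.1 V hV).prop.1
  obtain ⟨V, hV, hmin⟩ := exists_isMinimalReducing_le hred.orthogonal
    (fun h => htop ((Submodule.orthogonal_eq_bot_iff).1 h))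
  have hperp : ∀ W ∈ c, V ⟂ W := fun W hW =>
    hV.trans (Submodule.orthogonal_le (le_sSup hW))
  -- Maximality of the family puts `V` in it, although `V` is orthogonal to all its members, hence
  -- to itself.
  have hmem : V ∈ c := by
    refine hc.2 (y := insert V c) ⟨?_, ?_⟩ (Set.subset_insert V c) (Set.mem_insert V c)
    · rintro W (rfl | hW)
      · exact hmin
      · exact hc.prop.1 W hW
    · rintro W (rfl | hW) W' (rfl | hW') hne
      · exact absurd rfl hne
      · exact hperp W' hW'
      · exact (hperp W hW).symm
      · exact hc.prop.2 W hW W' hW' hne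
  exact hmin.prop.2 (Submodule.isOrtho_self.1 (hperp V hmem))

/-- Two subspaces are equivalent if a partial isometry of the commutant of `s` maps one onto the
other. -/
def CommutantEquiv (s : Set (K →L[ℂ] K)) (V W : Submodule ℂ K) : Prop :=
  ∃ u ∈ StarSubalgebra.centralizer ℂ s,
    star u * u = V.starProjection ∧ u * star u = W.starProjection

theorem CommutantEquiv.symm {V W : Submodule ℂ K} (h : CommutantEquiv s V W) :
    CommutantEquiv s W V := by
  obtain ⟨u, hu, h1, h2⟩ := h
  exact ⟨star u, star_mem hu, by rwa [star_star], by rwa [star_star]⟩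

theorem CommutantEquiv.trans {V W X : Submodule ℂ K} (h : CommutantEquiv s V W)
    (h' : CommutantEquiv s W X) : CommutantEquiv s V X := by
  obtain ⟨u, hu, h1, h2⟩ := h
  obtain ⟨v, hv, h3, h4⟩ := h'
  refine ⟨v * u, mul_mem hv hu, ?_, ?_⟩
  · have e : star (v * u) * (v * u) = star u * (star v * v) * u := by
      simp only [star_mul, mul_assoc]
    rw [e, h3, ← h2, ← mul_assoc, h1, mul_assoc, h1]
    exact isStarProjection_starProjection.isIdempotentElem
  · have e : v * u * star (v * u) = v * (u * star u) * star v := by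
      simp only [star_mul, mul_assoc]
    rw [e, h2, ← h3, ← mul_assoc, h4, mul_assoc, h4]
    exact isStarProjection_starProjection.isIdempotentElem

/-- For `b = W a V`, Schur's lemma makes `b† b` and `b b†` multiples of the projectors onto `V` and
`W`. Comparing the two readings of `b b† b` shows that the factors agree; the common factor is
positive, and dividing `b` by its square root gives the partial isometry. -/
theorem IsMinimalReducing.commutantEquiv {V W : Submodule ℂ K} (hV : IsMinimalReducing s V)
    (hW : IsMinimalReducing s W) {a : K →L[ℂ] K} (ha : a ∈ StarSubalgebra.centralizer ℂ s)
    (h0 : W.starProjection * a * V.starProjection ≠ 0) : CommutantEquiv s V W := by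
  have hpV := hV.prop.1.starProjection_mem
  have hpW := hW.prop.1.starProjection_mem
  have hVi : V.starProjection * V.starProjection = V.starProjection :=
    isStarProjection_starProjection.isIdempotentElem
  have hWi : W.starProjection * W.starProjection = W.starProjection :=
    isStarProjection_starProjection.isIdempotentElem
  have hVs : star V.starProjection = V.starProjection :=
    isStarProjection_starProjection.isSelfAdjoint
  have hWs : star W.starProjection = W.starProjection :=
    isStarProjection_starProjection.isSelfAdjoint
  obtain ⟨b, hb⟩ : ∃ b, b = W.starProjection * a * V.starProjection := ⟨_, rfl⟩
  rw [← hb] at h0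
  have hbA : b ∈ StarSubalgebra.centralizer ℂ s := hb ▸ mul_mem (mul_mem hpW ha) hpV
  have hbV : b * V.starProjection = b := by rw [hb, mul_assoc, hVi]
  have hWb : W.starProjection * b = b := by rw [hb, ← mul_assoc, ← mul_assoc, hWi]
  have hVb : V.starProjection * star b = star b := by
    have := congrArg star hbV
    rwa [star_mul, hVs] at this
  have hbW : star b * W.starProjection = star b := by
    have := congrArg star hWb
    rwa [star_mul, hWs] at this
  have hmem : ∀ {U : Submodule ℂ K} {c : K →L[ℂ] K}, U.starProjection * c = c → ∀ x, c x ∈ U := by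
    intro U c h x
    rw [← h]
    exact Submodule.starProjection_apply_mem U _
  have hscal : ∀ {U : Submodule ℂ K} {c : K →L[ℂ] K} {t : ℂ}, c * U.starProjection = c →
      (∀ x ∈ U, c x = t • x) → c = t • U.starProjection := by
    intro U c t h h'
    ext x
    rw [← h]
    exact h' _ (Submodule.starProjection_apply_mem U x)
  obtain ⟨t, ht⟩ := hV.exists_smul (mul_mem (star_mem hbA) hbA)
    (fun x _ => hmem (by rw [← mul_assoc, hVb]) x)
  obtain ⟨r, hr⟩ := hW.exists_smul (mul_mem hbA (star_mem hbA))
    (fun x _ => hmem (by rw [← mul_assoc, hWb]) x)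
  have ht' : star b * b = t • V.starProjection := hscal (by rw [mul_assoc, hbV]) ht
  have hr' : b * star b = r • W.starProjection := hscal (by rw [mul_assoc, hbW]) hr
  have hrt : t = r := by
    have h1 : b * (star b * b) = t • b := by rw [ht', mul_smul_comm, hbV]
    have h2 : b * (star b * b) = r • b := by rw [← mul_assoc, hr', smul_mul_assoc, hWb]
    exact smul_left_injective ℂ h0 (h1.symm.trans h2)
  obtain ⟨v, hv, hv0⟩ := (Submodule.ne_bot_iff V).1 hV.prop.2
  have htpos : 0 ≤ t := by
    have h1 : (0 : ℂ) ≤ inner ℂ v ((star b * b) v) :=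
      ((ContinuousLinearMap.nonneg_iff_isPositive _).1 (star_mul_self_nonneg b)).inner_nonneg_right v
    rw [ht v hv, inner_smul_right, inner_self_eq_norm_sq_to_K] at h1
    have h2 : ((‖v‖ : ℂ) ^ 2) ≠ 0 := by simpa using hv0
    have h3 : (0 : ℂ) ≤ ((‖v‖ : ℂ) ^ 2)⁻¹ := by
      rw [← Complex.ofReal_pow, ← Complex.ofReal_inv, Complex.zero_le_real]
      positivity
    have h4 := mul_nonneg h1 h3
    exact h4.trans_eq (mul_inv_cancel_right₀ h2 t)
  have ht0 : t ≠ 0 := by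
    rintro rfl
    rw [zero_smul] at ht'
    exact h0 ((CStarRing.star_mul_self_eq_zero_iff b).1 ht')
  obtain ⟨q, hq0, rfl⟩ : ∃ q : ℝ, 0 < q ∧ t = (q : ℂ) := by
    have h1 : t = (t.re : ℂ) := Complex.eq_re_of_ofReal_le (r := 0) (by simpa using htpos)
    refine ⟨t.re, lt_of_le_of_ne (Complex.le_def.1 htpos).1 fun h => ht0 ?_, h1⟩
    rw [h1, ← h]
    simp
  subst hrt
  have hc : (((Real.sqrt q)⁻¹ : ℝ) : ℂ) * (((Real.sqrt q)⁻¹ : ℝ) : ℂ) * (q : ℂ) = 1 := by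
    rw [← Complex.ofReal_mul, ← Complex.ofReal_mul, ← mul_inv, Real.mul_self_sqrt hq0.le,
      inv_mul_cancel₀ hq0.ne', Complex.ofReal_one]
  refine ⟨(((Real.sqrt q)⁻¹ : ℝ) : ℂ) • b, SMulMemClass.smul_mem _ hbA, ?_, ?_⟩
  · rw [star_smul, Complex.star_def, Complex.conj_ofReal, smul_mul_smul_comm, ht', smul_smul, hc,
      one_smul]
  · rw [star_smul, Complex.star_def, Complex.conj_ofReal, smul_mul_smul_comm, hr', smul_smul, hc,
      one_smul]

end Reducing

/-! ### Block form of the commutant -/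

section Structure

variable {K : Type*} [NormedAddCommGroup K] [InnerProductSpace ℂ K] [CompleteSpace K]
  [FiniteDimensional ℂ K] (s : Set (K →L[ℂ] K))

/-- The space is covered by partial isometries of the commutant, which map finitely many
inequivalent minimal reducing subspaces onto mutually orthogonal subspaces. -/
theorem exists_partialIsometries : ∃ (N : ℕ) (d : Fin N → ℕ) (V : Fin N → Submodule ℂ K)
    (u : (Σ k, Fin (d k)) → K →L[ℂ] K), (∀ k, 0 < d k) ∧ (∀ k, IsMinimalReducing s (V k)) ∧
    (∀ k k', CommutantEquiv s (V k) (V k') → k = k') ∧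
    (∀ x, u x ∈ StarSubalgebra.centralizer ℂ s) ∧
    (∀ x, star (u x) * u x = (V x.1).starProjection) ∧
    (∀ x y, x ≠ y → star (u x) * u y = 0) ∧ ⨆ x, (u x : K →ₗ[ℂ] K).range = ⊤ := by
  classical
  obtain ⟨c, hmin, hperp, htop⟩ := exists_orthogonal_isMinimalReducing s
  have hfam : OrthogonalFamily ℂ (fun i : c => (i : Submodule ℂ K))
      fun i => (i : Submodule ℂ K).subtypeₗᵢ :=
    OrthogonalFamily.of_pairwise fun i j hij =>
      hperp i i.2 j j.2 fun h => hij (Subtype.ext h)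
  have : Finite c := WellFoundedGT.finite_of_iSupIndep hfam.independent
    fun i => (hmin i i.2).prop.2
  let r : Setoid c := ⟨fun i j => CommutantEquiv s (i : Submodule ℂ K) j,
    fun i => ⟨_, (hmin i i.2).prop.1.starProjection_mem,
      by rw [isStarProjection_starProjection.isSelfAdjoint.star_eq,
        isStarProjection_starProjection.isIdempotentElem],
      by rw [isStarProjection_starProjection.isSelfAdjoint.star_eq,
        isStarProjection_starProjection.isIdempotentElem]⟩,
    CommutantEquiv.symm, CommutantEquiv.trans⟩
  have := Fintype.ofFinite c
  have := Fintype.ofFinite (Quotient r)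
  let e : Fin (Fintype.card (Quotient r)) ≃ Quotient r := (Fintype.equivFin _).symm
  let rep (k : Fin (Fintype.card (Quotient r))) : c := (e k).out
  have hrep : ∀ k, (⟦rep k⟧ : Quotient r) = e k := fun k => Quotient.out_eq _
  let d (k : Fin (Fintype.card (Quotient r))) : ℕ :=
    Fintype.card {i : c // (⟦i⟧ : Quotient r) = e k}
  let f (k : Fin (Fintype.card (Quotient r))) : Fin (d k) ≃ {i : c // (⟦i⟧ : Quotient r) = e k} :=
    (Fintype.equivFin _).symm
  -- The orthogonal summands are relabelled by pairs of an equivalence class and a position in it.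
  -- The class size `d k` is the multiplicity, the dimension of `A_k`.
  let F (x : Σ k, Fin (d k)) : c := (f x.1 x.2).1
  have hF : Function.Injective F := by
    rintro ⟨k, a⟩ ⟨k', a'⟩ h
    have h1 : (⟦(f k a).1⟧ : Quotient r) = e k := (f k a).2
    have h2 : (⟦(f k' a').1⟧ : Quotient r) = e k' := (f k' a').2
    change (f k a).1 = (f k' a').1 at h
    obtain rfl : k = k' := e.injective (by rw [← h1, ← h2, h])
    rw [(f k).injective (Subtype.ext h)]
  have hFs : Function.Surjective F := by
    intro i
    refine ⟨⟨e.symm ⟦i⟧, (f _).symm ⟨i, by rw [e.apply_symm_apply]⟩⟩, ?_⟩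
    simp [F]
  have hequiv : ∀ x : Σ k, Fin (d k), CommutantEquiv s (rep x.1 : Submodule ℂ K) (F x) := by
    rintro ⟨k, a⟩
    have h : (⟦rep k⟧ : Quotient r) = ⟦(f k a).1⟧ := (hrep k).trans (f k a).2.symm
    exact Quotient.exact h
  choose u hu h1 h2 using hequiv
  refine ⟨_, d, fun k => rep k, u, fun k => ?_, fun k => hmin _ (rep k).2, fun k k' h => ?_, hu, h1,
    fun x y hxy => ?_, ?_⟩
  · exact Fintype.card_pos_iff.2 ⟨⟨rep k, hrep k⟩⟩
  · refine e.injective ?_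
    rw [← hrep, ← hrep]
    exact Quotient.sound h
  · have hx : star (u x) * (F x : Submodule ℂ K).starProjection = star (u x) :=
      by rw [← h2 x, ← mul_assoc, h1 x]
         have := congrArg star (eq_mul_of_star_mul_self_eq isStarProjection_starProjection (h1 x))
         rwa [star_mul, isStarProjection_starProjection.isSelfAdjoint.star_eq] at this
    have hy : (F y : Submodule ℂ K).starProjection * u y = u y := by
      rw [← h2 y, mul_assoc, h1 y]
      exact eq_mul_of_star_mul_self_eq isStarProjection_starProjection (h1 y)
    have h0 : (F x : Submodule ℂ K).starProjection * (F y : Submodule ℂ K).starProjection = 0 :=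
      (hperp _ (F x).2 _ (F y).2 fun h => hxy (hF (Subtype.ext h))).starProjection_comp_starProjection
    rw [← hx, ← hy, mul_assoc, ← mul_assoc (Submodule.starProjection _), h0, zero_mul, mul_zero]
  · rw [eq_top_iff, ← htop]
    refine sSup_le fun W hW => ?_
    obtain ⟨x, hx⟩ := hFs ⟨W, hW⟩
    refine le_iSup_of_le x fun w hw => ⟨star (u x) w, ?_⟩
    have := congrArg (fun b : K →L[ℂ] K => b w) (h2 x)
    rw [hx] at this
    exact this.trans (Submodule.starProjection_eq_self_iff.2 hw)

/-- The commutant of a selfadjoint set of operators is `⨁ₖ M_{Aₖ} ⊗ 1_{Bₖ}`. -/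
theorem exists_sectorDecomposition : ∃ σ : SectorDecomposition K,
    (StarSubalgebra.centralizer ℂ s : Set (K →L[ℂ] K)) = σ.blockSet 1 := by
  classical
  obtain ⟨N, d, V, u, hd, hmin, hne, hu, h1, h2, htop⟩ := exists_partialIsometries s
  let n (k : Fin N) : ℕ := Module.finrank ℂ (V k)
  let f (k : Fin N) : OrthonormalBasis (Fin (n k)) ℂ (V k) := stdOrthonormalBasis ℂ (V k)
  -- `V k` plays the role of `B_k`: `u ⟨k, a⟩` carries it to its copy with label `a`, with one basis
  -- of `V k` used for all copies.
  let v (x : Σ k : Fin N, Fin (d k) × Fin (n k)) : K := u ⟨x.1, x.2.1⟩ (f x.1 x.2.2)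
  have hinner : ∀ (X : K →L[ℂ] K) (k k' : Fin N) (a : Fin (d k)) (a' : Fin (d k')) (b : Fin (n k))
      (b' : Fin (n k')), inner ℂ (v ⟨k, a, b⟩) (X (v ⟨k', a', b'⟩)) =
      inner ℂ (f k b : K) ((star (u ⟨k, a⟩) * X * u ⟨k', a'⟩) (f k' b')) := by
    intro X k k' a a' b b'
    rw [mul_assoc, mul_apply_eq_comp, ContinuousLinearMap.star_eq_adjoint,
      ContinuousLinearMap.adjoint_inner_right]
    rfl
  have hon : Orthonormal ℂ v := by
    rw [orthonormal_iff_ite]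
    rintro ⟨k, a, b⟩ ⟨k', a', b'⟩
    have h := hinner 1 k k' a a' b b'
    rw [one_apply_eq_self, mul_one] at h
    rw [h]
    by_cases hx : (⟨k, a⟩ : Σ k, Fin (d k)) = ⟨k', a'⟩
    · cases hx
      rw [h1, Submodule.starProjection_eq_self_iff.2 (f k b').2, ← Submodule.coe_inner,
        (f k).inner_eq_ite]
      simp
    · rw [h2 _ _ hx, zero_apply, inner_zero_right, if_neg]
      intro h
      cases h
      exact hx rfl
  have hVspan : ∀ k, V k ≤ Submodule.span ℂ (Set.range fun b => (f k b : K)) := by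
    intro k z hz
    have : _ = z := congrArg Subtype.val ((f k).sum_repr' ⟨z, hz⟩)
    rw [← this, Submodule.coe_sum]
    exact Submodule.sum_mem _ fun b _ => Submodule.smul_mem _ _ (Submodule.subset_span ⟨b, rfl⟩)
  have hsp : ⊤ ≤ Submodule.span ℂ (Set.range v) := by
    rw [← htop]
    refine iSup_le ?_
    rintro ⟨k, a⟩ _ ⟨y, rfl⟩
    have hle : V k ≤ (Submodule.span ℂ (Set.range v)).comap (u ⟨k, a⟩ : K →ₗ[ℂ] K) := by
      refine (hVspan k).trans (Submodule.span_le.2 ?_)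
      rintro _ ⟨b, rfl⟩
      exact Submodule.subset_span ⟨⟨k, a, b⟩, rfl⟩
    have := eq_mul_of_star_mul_self_eq isStarProjection_starProjection (h1 ⟨k, a⟩)
    change u ⟨k, a⟩ y ∈ _
    rw [← this]
    exact hle (Submodule.starProjection_apply_mem _ _)
  let σ : SectorDecomposition K :=
    { sectors := N
      d := d
      n := n
      d_pos := hd
      n_pos := fun k => Module.finrank_pos_iff.2
        (Submodule.nontrivial_iff_ne_bot.2 (hmin k).prop.2)
      U := (OrthonormalBasis.mk hon hsp).repr }
  have hσ : ∀ x, σ.basis x = v x := fun x => congrFun (OrthonormalBasis.coe_mk hon hsp) x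
  refine ⟨σ, Set.Subset.antisymm ?_ ?_⟩
  · intro X hX
    have hVu : ∀ k a (Y : K →L[ℂ] K),
        (V k).starProjection * (star (u ⟨k, a⟩) * Y) = star (u ⟨k, a⟩) * Y := by
      intro k a Y
      have := congrArg star
        (eq_mul_of_star_mul_self_eq isStarProjection_starProjection (h1 ⟨k, a⟩))
      rw [star_mul, isStarProjection_starProjection.isSelfAdjoint.star_eq] at this
      rw [← mul_assoc, this]
    -- Pulled back to `V k`, each block of `X` lies in the commutant, so it is a scalar by Schur's
    -- lemma; the scalars form the matrix `M k`.
    have hscal : ∀ k a a', ∃ c : ℂ, ∀ z ∈ V k, (star (u ⟨k, a⟩) * X * u ⟨k, a'⟩) z = c • z :=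
      fun k a a' => (hmin k).exists_smul (mul_mem (mul_mem (star_mem (hu _)) hX) (hu _))
        fun z _ => by
          rw [mul_assoc, ← hVu]
          exact Submodule.starProjection_apply_mem _ _
    choose M hM using hscal
    refine ⟨fun k => Matrix.of (M k), ?_⟩
    change σ.op _ 1 = X
    rw [op_eq_sum_rankOne σ.basis X, op_eq_sum_rankOne σ.basis (σ.op _ 1)]
    refine Finset.sum_congr rfl fun x _ => Finset.sum_congr rfl fun y _ => ?_
    congr 1
    obtain ⟨k, a, b⟩ := x
    obtain ⟨k', a', b'⟩ := y
    rw [SectorDecomposition.inner_op, hσ, hσ, hinner]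
    by_cases hk : k = k'
    · subst hk
      rw [Matrix.blockDiagonal'_apply_eq, Matrix.kroneckerMap_apply, hM k a a' _ (f k b').2,
        inner_smul_right, ← Submodule.coe_inner, (f k).inner_eq_ite]
      simp [Matrix.one_apply]
    · rw [Matrix.blockDiagonal'_apply_ne _ _ _ hk]
      -- A nonzero block between different sectors would make `V k'` and `V k` equivalent.
      have h0 : (V k).starProjection * (star (u ⟨k, a⟩) * X * u ⟨k', a'⟩) *
          (V k').starProjection = 0 := by
        by_contra h0
        exact hk (hne _ _ ((hmin k').commutantEquiv (hmin k)
          (mul_mem (mul_mem (star_mem (hu _)) hX) (hu _)) h0)).symm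
      have h3 := congrArg (fun Y : K →L[ℂ] K => Y (f k' b')) h0
      rw [mul_assoc (star _), hVu, mul_apply_eq_comp,
        Submodule.starProjection_eq_self_iff.2 (f k' b').2, ← mul_assoc] at h3
      rw [h3, zero_apply, inner_zero_right]
  · rintro _ ⟨M, rfl⟩
    have hunit : ∀ k a a', ∑ b, σ.unit ⟨k, a, b⟩ ⟨k, a', b⟩ = u ⟨k, a⟩ * star (u ⟨k, a'⟩) := by
      intro k a a'
      have h := eq_mul_of_star_mul_self_eq isStarProjection_starProjection (h1 ⟨k, a⟩)
      conv_rhs => rw [← h, (f k).starProjection_eq_sum_rankOne]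
      rw [Finset.mul_sum, Finset.sum_mul]
      refine Finset.sum_congr rfl fun b _ => ?_
      rw [SectorDecomposition.unit, hσ, hσ]
      ext y
      simp [v, InnerProductSpace.rankOne_apply, ContinuousLinearMap.star_eq_adjoint,
        ContinuousLinearMap.adjoint_inner_right]
    have hop : σ.op M 1 = ∑ k, ∑ a, ∑ a', M k a a' • (u ⟨k, a⟩ * star (u ⟨k, a'⟩)) := by
      rw [SectorDecomposition.op_eq_sum_unit]
      refine Finset.sum_congr rfl fun k _ => Finset.sum_congr rfl fun a _ => ?_
      rw [Finset.sum_comm]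
      refine Finset.sum_congr rfl fun a' _ => ?_
      rw [← hunit, Finset.smul_sum]
      refine Finset.sum_congr rfl fun b _ => ?_
      rw [Finset.sum_eq_single b]
      · simp
      · intro b' _ hb
        simp [Matrix.one_apply_ne hb.symm]
      · simp
    change σ.op M 1 ∈ StarSubalgebra.centralizer ℂ s
    rw [hop]
    exact sum_mem fun k _ => sum_mem fun a _ => sum_mem fun a' _ =>
      SMulMemClass.smul_mem _ (mul_mem (hu _) (star_mem (hu _)))

end Structure

/-! ### Matrix units and distortion maps -/

namespace SectorDecomposition

variable {K : Type*} [NormedAddCommGroup K] [InnerProductSpace ℂ K] (σ : SectorDecomposition K)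

theorem op_single_single_one (k : Fin σ.sectors) (a a' : Fin (σ.d k)) :
    σ.op (Pi.single k (Matrix.single a a' 1)) 1 = ∑ b, σ.unit ⟨k, a, b⟩ ⟨k, a', b⟩ := by
  classical
  rw [op_single, Finset.sum_eq_single a]
  · refine Finset.sum_congr rfl fun b _ => ?_
    rw [Finset.sum_eq_single a', Finset.sum_eq_single b]
    · simp
    · intro b' _ hb
      simp [Matrix.one_apply_ne hb.symm]
    · simp
    · intro a'' _ ha
      simp [Matrix.single_apply_of_col_ne _ _ ha.symm]
    · simp
  · intro a'' _ ha
    simp [Matrix.single_apply_of_row_ne ha.symm]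
  · simp

/-- The compression of an operator to `|a₀⟩⟨a₀| ⊗ B_k` is spread over the sector `k` by matrix
units. -/
theorem op_one_eq_sum_conj (ρ : K →L[ℂ] K) (a₀ : ∀ k, Fin (σ.d k)) :
    σ.op 1 (fun k => Matrix.of fun b b' =>
      inner ℂ (σ.basis ⟨k, a₀ k, b⟩) (ρ (σ.basis ⟨k, a₀ k, b'⟩))) =
    ∑ k, ∑ a, σ.op (Pi.single k (Matrix.single a (a₀ k) 1)) 1 * ρ *
      σ.op (Pi.single k (Matrix.single (a₀ k) a 1)) 1 := by
  classical
  rw [op_eq_sum_unit]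
  refine Finset.sum_congr rfl fun k _ => Finset.sum_congr rfl fun a _ => ?_
  rw [op_single_single_one, op_single_single_one, Finset.sum_mul, Finset.sum_mul]
  refine Finset.sum_congr rfl fun b _ => ?_
  rw [Finset.sum_eq_single a, Finset.mul_sum]
  · refine Finset.sum_congr rfl fun b' _ => ?_
    ext x
    simp [InnerProductSpace.rankOne_apply, smul_smul, mul_comm]
  · intro a' _ ha
    simp [Matrix.one_apply_ne ha.symm]
  · simp

variable [CompleteSpace K]

open scoped MatrixOrder in
/-- Every family of positive semidefinite `τ k` with trace `n k` is attained by a distortion map. -/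
theorem exists_isDistortionMap (τ : ∀ k, Matrix (Fin (σ.n k)) (Fin (σ.n k)) ℂ)
    (hτ : ∀ k, (τ k).PosSemidef) (htr : ∀ k, (τ k).trace = σ.n k) [FiniteDimensional ℂ K] :
    ∃ D, σ.IsDistortionMap τ D := by
  classical
  have hC : ∀ k, ∃ C : Matrix (Fin (σ.n k)) (Fin (σ.n k)) ℂ, τ k = C * star C := fun k => by
    obtain ⟨B, hB⟩ := CStarAlgebra.nonneg_iff_eq_star_mul_self.1 (hτ k).nonneg
    exact ⟨star B, by rw [star_star]; exact hB⟩
  choose C hC using hC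
  let c (k : Fin σ.sectors) : ℂ := (((Real.sqrt (σ.n k))⁻¹ : ℝ) : ℂ)
  have hcs : ∀ k, star (c k) = c k := fun k => Complex.conj_ofReal _
  have hc : ∀ k, c k * c k * (σ.n k : ℂ) = 1 := fun k => by
    have h : (0 : ℝ) < σ.n k := Nat.cast_pos.2 (σ.n_pos k)
    rw [← Complex.ofReal_natCast, ← Complex.ofReal_mul, ← Complex.ofReal_mul, ← mul_inv,
      Real.mul_self_sqrt h.le, inv_mul_cancel₀ h.ne', Complex.ofReal_one]
  -- On `B_k` these Kraus operators give `N ↦ tr(N) τ k / n k`, since `τ k = C k (C k)†`. This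
  -- preserves the trace because `tr (τ k) = n k`, and sends `1` to `τ k`.
  let g (x : Σ k, Fin (σ.n k) × Fin (σ.n k)) : Matrix (Fin (σ.n x.1)) (Fin (σ.n x.1)) ℂ :=
    c x.1 • (C x.1 * Matrix.single x.2.1 x.2.2 1)
  let G (x : Σ k, Fin (σ.n k) × Fin (σ.n k)) : K →L[ℂ] K :=
    σ.op (Pi.single x.1 1) (Pi.single x.1 (g x))
  have hsingle : ∀ (k : Fin σ.sectors) (M : ∀ k, Matrix (Fin (σ.d k)) (Fin (σ.d k)) ℂ),
      (fun l => (Pi.single k 1 : ∀ k, Matrix (Fin (σ.d k)) (Fin (σ.d k)) ℂ) l * M l *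
        star ((Pi.single k 1 : ∀ k, Matrix (Fin (σ.d k)) (Fin (σ.d k)) ℂ) l)) =
      Pi.single k (M k) := by
    intro k M
    funext l
    by_cases h : l = k
    · subst h
      simp
    · simp [Pi.single_eq_of_ne h]
  have hsingle' : ∀ k : Fin σ.sectors,
      (fun l => star ((Pi.single k 1 : ∀ k, Matrix (Fin (σ.d k)) (Fin (σ.d k)) ℂ) l) *
        (Pi.single k 1 : ∀ k, Matrix (Fin (σ.d k)) (Fin (σ.d k)) ℂ) l) = Pi.single k 1 := by
    intro k
    funext l
    by_cases h : l = k
    · subst h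
      simp
    · simp [Pi.single_eq_of_ne h]
  refine ⟨krausCP G, ?_, hτ, fun M => ?_⟩
  · rw [krausCP_toLinearMap, isTracePreserving_krausMap_iff, Fintype.sum_sigma,
      ← σ.op_one_one, ← σ.sum_op_single]
    refine Finset.sum_congr rfl fun k _ => ?_
    have e : ∀ p : Fin (σ.n k) × Fin (σ.n k), star (G ⟨k, p⟩) * G ⟨k, p⟩ =
        σ.op (Pi.single k 1) (Pi.single k (star (g ⟨k, p⟩) * g ⟨k, p⟩)) := by
      intro p
      rw [star_op, op_mul, hsingle']
      refine σ.op_single_congr k _ ?_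
      simp
    simp only [e]
    rw [sum_op_right]
    refine σ.op_single_congr k _ ?_
    simp only [Pi.single_eq_same, Pi.one_apply]
    have e' : ∀ p : Fin (σ.n k) × Fin (σ.n k), star (g ⟨k, p⟩) * g ⟨k, p⟩ =
        (c k * c k * (star (C k) * C k) p.1 p.1) • Matrix.single p.2 p.2 1 := by
      intro p
      have hs : star (Matrix.single p.1 p.2 (1 : ℂ)) = Matrix.single p.2 p.1 1 := by
        rw [Matrix.star_eq_conjTranspose, Matrix.conjTranspose_single, star_one]
      simp only [g, star_smul, star_mul, hcs, smul_mul_smul_comm, hs]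
      rw [mul_assoc, ← mul_assoc (star (C k)), ← mul_assoc, Matrix.single_mul_mul_single,
        one_mul, mul_one, Matrix.smul_single, Matrix.smul_single, smul_eq_mul, smul_eq_mul,
        mul_one]
    simp only [e']
    rw [Fintype.sum_prod_type]
    simp only [← Finset.smul_sum, Matrix.sum_single_one]
    rw [← Finset.sum_smul, ← Finset.mul_sum]
    have ht : ∑ b, (star (C k) * C k) b b = σ.n k := by
      rw [← htr k, hC k]
      exact Matrix.trace_mul_comm _ _
    rw [ht, hc, one_smul]
  · rw [krausCP_apply, krausMap_apply, Fintype.sum_sigma, ← σ.sum_op_single M τ]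
    refine Finset.sum_congr rfl fun k _ => ?_
    have e : ∀ p : Fin (σ.n k) × Fin (σ.n k), G ⟨k, p⟩ * σ.op M 1 * star (G ⟨k, p⟩) =
        σ.op (Pi.single k (M k)) (Pi.single k (g ⟨k, p⟩ * star (g ⟨k, p⟩))) := by
      intro p
      rw [star_op, op_mul, op_mul, hsingle]
      refine σ.op_single_congr k _ ?_
      simp
    simp only [e]
    rw [sum_op_right]
    refine σ.op_single_congr k _ ?_
    simp only [Pi.single_eq_same]
    have e' : ∀ p : Fin (σ.n k) × Fin (σ.n k), g ⟨k, p⟩ * star (g ⟨k, p⟩) =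
        (c k * c k) • (C k * Matrix.single p.1 p.1 1 * star (C k)) := by
      intro p
      have hs : star (Matrix.single p.1 p.2 (1 : ℂ)) = Matrix.single p.2 p.1 1 := by
        rw [Matrix.star_eq_conjTranspose, Matrix.conjTranspose_single, star_one]
      simp only [g, star_smul, star_mul, hcs, smul_mul_smul_comm, hs]
      rw [mul_assoc (C k), ← mul_assoc (Matrix.single _ _ _), Matrix.single_mul_single_same,
        one_mul, ← mul_assoc]
    simp only [e']
    rw [Fintype.sum_prod_type]
    simp only [Finset.sum_const, Finset.card_univ, Fintype.card_fin]
    rw [← Finset.smul_sum, ← Finset.smul_sum, ← Finset.sum_mul, ← Finset.mul_sum,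
      Matrix.sum_single_one, mul_one, ← hC, ← Nat.cast_smul_eq_nsmul ℂ, smul_smul, mul_comm, hc,
      one_smul]

end SectorDecomposition

/-! ### Fixed points as a distorted algebra -/

section FixedPoints

variable {K : Type*} [NormedAddCommGroup K] [InnerProductSpace ℂ K] [CompleteSpace K]
  [FiniteDimensional ℂ K] {ι : Type*} [Fintype ι]

/-- The fixed points of a channel with a faithful invariant state are `⨁ₖ M_{Aₖ} ⊗ τₖ` if the
commutant of its Kraus operators is `⨁ₖ M_{Aₖ} ⊗ 1_{Bₖ}`. -/
theorem exists_Fix_eq_blockSet {L : ι → K →L[ℂ] K} (hL : IsTracePreserving (krausMap L))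
    {ρ : K →L[ℂ] K} (hρ : 0 ≤ ρ) (hfix : ρ ∈ Fix (krausMap L)) (hinj : ∀ x, ρ x = 0 → x = 0)
    (σ : SectorDecomposition K)
    (hσ : (StarSubalgebra.centralizer ℂ (Set.range L) : Set (K →L[ℂ] K)) = σ.blockSet 1) :
    ∃ τ : ∀ k, Matrix (Fin (σ.n k)) (Fin (σ.n k)) ℂ, (∀ k, (τ k).PosSemidef) ∧
      (∀ k, (τ k).trace = σ.n k) ∧ (Fix (krausMap L) : Set (K →L[ℂ] K)) = σ.blockSet τ := by
  let a₀ (k : Fin σ.sectors) : Fin (σ.d k) := ⟨0, σ.d_pos k⟩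
  let τ₀ (k : Fin σ.sectors) : Matrix (Fin (σ.n k)) (Fin (σ.n k)) ℂ := Matrix.of fun b b' =>
    inner ℂ (σ.basis ⟨k, a₀ k, b⟩) (ρ (σ.basis ⟨k, a₀ k, b'⟩))
  have hmem : ∀ M, σ.op M 1 ∈ StarSubalgebra.centralizer ℂ (Set.range L) := fun M => by
    rw [← SetLike.mem_coe, hσ]
    exact ⟨M, rfl⟩
  have hτ₀ : ∀ k, (τ₀ k).PosSemidef := by
    intro k
    obtain ⟨B, hB⟩ := exists_eq_star_mul_self_of_nonneg hρ
    have h : τ₀ k = Matrix.gram ℂ fun b => B (σ.basis ⟨k, a₀ k, b⟩) := by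
      ext b b'
      rw [Matrix.gram_apply]
      change inner ℂ _ (ρ _) = _
      rw [hB, mul_apply_eq_comp,
        ContinuousLinearMap.star_eq_adjoint, ContinuousLinearMap.adjoint_inner_right]
    rw [h]
    exact Matrix.posSemidef_gram _ _
  have htr0 : ∀ k, (τ₀ k).trace ≠ 0 := by
    intro k h
    have hn : ∀ x, 0 ≤ inner ℂ (σ.basis x) (ρ (σ.basis x)) := fun x =>
      ((ContinuousLinearMap.nonneg_iff_isPositive ρ).1 hρ).inner_nonneg_right _
    have h0 := (Finset.sum_eq_zero_iff_of_nonneg fun b _ => hn ⟨k, a₀ k, b⟩).1 h ⟨0, σ.n_pos k⟩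
      (Finset.mem_univ _)
    exact σ.basis.toBasis.ne_zero ⟨k, a₀ k, ⟨0, σ.n_pos k⟩⟩
      (by simpa using hinj _ (apply_eq_zero_of_inner_eq_zero hρ h0))
  -- The operator is a sum of terms `e ρ e'` with `e`, `e'` in the commutant, and multiplication by
  -- the commutant on either side passes through the channel.
  have hfix₀ : σ.op 1 τ₀ ∈ Fix (krausMap L) := by
    rw [σ.op_one_eq_sum_conj ρ a₀]
    refine sum_mem fun k _ => sum_mem fun a _ => ?_
    rw [mem_Fix, krausMap_mul_right (hmem _), krausMap_mul_left (hmem _), mem_Fix.1 hfix]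
  -- The trace is normalized to that of `1` on `B_k`, as a trace-preserving distortion map requires.
  let c (k : Fin σ.sectors) : ℂ := σ.n k / (τ₀ k).trace
  have htrace : ∀ k, (c k • τ₀ k).trace = σ.n k := fun k => by
    rw [Matrix.trace_smul, smul_eq_mul, div_mul_cancel₀ _ (htr0 k)]
  refine ⟨fun k => c k • τ₀ k, fun k => ?_, htrace, ?_⟩
  · exact (hτ₀ k).smul (div_nonneg (Nat.cast_nonneg _) (hτ₀ k).trace_nonneg)
  have hne : ∀ k, c k • τ₀ k ≠ 0 := fun k h => by
    have := htrace k
    rw [h, Matrix.trace_zero] at this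
    exact (σ.n_pos k).ne (Nat.cast_eq_zero.1 this.symm).symm
  have hone : ∀ k, (1 : ∀ k, Matrix (Fin (σ.n k)) (Fin (σ.n k)) ℂ) k ≠ 0 := fun k => by
    have : Nonempty (Fin (σ.n k)) := ⟨⟨0, σ.n_pos k⟩⟩
    exact one_ne_zero
  have hle : (σ.opLin fun k => c k • τ₀ k).range ≤ Fix (krausMap L) := by
    rintro _ ⟨M, rfl⟩
    change σ.op M (fun k => c k • τ₀ k) ∈ _
    have e : σ.op M (fun k => c k • τ₀ k) = σ.op (fun k => c k • M k) 1 * σ.op 1 τ₀ := by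
      rw [σ.op_smul_right, σ.op_mul]
      simp only [Pi.one_apply, mul_one, one_mul]
    rw [e, mem_Fix, krausMap_mul_left (hmem _), mem_Fix.1 hfix₀]
  have hA : Fix (hsAdjoint (krausMap L)) = (σ.opLin 1).range := by
    refine SetLike.coe_injective ?_
    rw [Fix_hsAdjoint_eq_centralizer hL hρ hfix hinj, hσ, σ.coe_range_opLin]
  rw [← σ.coe_range_opLin]
  refine congrArg _ (Submodule.eq_of_le_of_finrank_eq hle ?_).symm
  -- Both block spaces are injective images of the same matrix space, as no `τ k` and no `1` is
  -- zero.
  rw [← finrank_Fix_hsAdjoint, hA, LinearMap.finrank_range_of_inj (σ.opLin_injective hne),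
    LinearMap.finrank_range_of_inj (σ.opLin_injective hone)]

end FixedPoints

end QChannel

end

/-! ### The main theorem -/

theorem mainTheorem2 {H : Type*} [NormedAddCommGroup H] [InnerProductSpace ℂ H]
    [FiniteDimensional ℂ H] [CompleteSpace H]
    (E : (H →L[ℂ] H) →CP (H →L[ℂ] H)) (hE : QChannel.IsTracePreserving E.toLinearMap)
    (P₀ : Submodule ℂ H) (hP₀ : P₀ = QChannel.support (QChannel.Fix E.toLinearMap : Set (H →L[ℂ] H))) :
    QChannel.IsInvariantSubspace E.toLinearMap P₀ ∧
    ∃ (A : StarSubalgebra ℂ (P₀ →L[ℂ] P₀)) (σ : QChannel.SectorDecomposition P₀)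
      (τ : ∀ k, Matrix (Fin (σ.n k)) (Fin (σ.n k)) ℂ)
      (D : (P₀ →L[ℂ] P₀) →CP (P₀ →L[ℂ] P₀)),
      (A : Set (P₀ →L[ℂ] P₀)) =
        QChannel.Fix (QChannel.hsAdjoint (QChannel.restrict E.toLinearMap P₀)) ∧
      (A : Set (P₀ →L[ℂ] P₀)) = σ.blockSet 1 ∧
      σ.IsDistortionMap τ D ∧
      (QChannel.Fix E.toLinearMap : Set (H →L[ℂ] H)) = QChannel.embed P₀ '' (D '' A) ∧
      (QChannel.Fix E.toLinearMap : Set (H →L[ℂ] H)) = QChannel.embed P₀ '' σ.blockSet τ ∧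
      QChannel.sandwich P₀ '' (QChannel.Fix (QChannel.hsAdjoint E.toLinearMap) : Set (H →L[ℂ] H)) =
        QChannel.embed P₀ '' A := by
  open QChannel in
  obtain ⟨n, K, hEK⟩ := exists_krausMap_eq E
  rw [hEK] at hE hP₀ ⊢
  obtain ⟨ρ, hρ, hρfix, hρP⟩ := exists_range_eq_support hE
  rw [← hP₀] at hρP
  have hK := mapsTo_range_of_mem_Fix hρ hρfix hρP
  have hinv := isInvariantSubspace_krausMap hK
  have hsand : ∀ X ∈ Fix (krausMap K), sandwich P₀ X = X := fun X hX => by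
    rw [hP₀]
    exact sandwich_eq_self_of_mem hX
  have hTP := isTracePreserving_krausMap_compress hK hE
  have hFix := Fix_eq_map_embed hinv hsand
  rw [restrict_krausMap] at hFix ⊢
  have hρ₀ : embed P₀ (compress P₀ ρ) = ρ := hsand ρ hρfix
  have hρ₀fix : compress P₀ ρ ∈ Fix (krausMap fun i => compress P₀ (K i)) := by
    rw [hFix] at hρfix
    obtain ⟨x, hx, rfl⟩ := hρfix
    rwa [compress_embed]
  -- On its own range `P₀`, the orthogonal complement of its kernel, `ρ` is faithful.
  have hinj : ∀ x, compress P₀ ρ x = 0 → x = 0 := by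
    intro x hx
    have h1 : ρ x = 0 := by rw [← hρ₀, embed_apply_coe, hx, Submodule.coe_zero]
    have h2 : (x : H) ∈ (ρ : H →ₗ[ℂ] H).kerᗮ := by
      rw [← range_eq_orthogonal_ker (IsSelfAdjoint.of_nonneg hρ), hρP]
      exact x.2
    exact Subtype.ext (inner_self_eq_zero.1 (h2 x h1))
  have hρ₀pos := compress_nonneg P₀ hρ
  obtain ⟨σ, hσ⟩ := exists_sectorDecomposition (Set.range fun i => compress P₀ (K i))
  obtain ⟨τ, hτ, htr, hτfix⟩ := exists_Fix_eq_blockSet hTP hρ₀pos hρ₀fix hinj σ hσ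
  obtain ⟨D, hD⟩ := σ.exists_isDistortionMap τ hτ htr
  have hA := Fix_hsAdjoint_eq_centralizer hTP hρ₀pos hρ₀fix hinj
  have hFix' : (Fix (krausMap K) : Set (H →L[ℂ] H)) = embed P₀ '' σ.blockSet τ := by
    rw [hFix, Submodule.map_coe, hτfix]
  have hDA : D '' σ.blockSet 1 = σ.blockSet τ := by
    rw [SectorDecomposition.blockSet, SectorDecomposition.blockSet, ← Set.range_comp]
    exact congrArg Set.range (funext hD.2.2)
  refine ⟨hinv, StarSubalgebra.centralizer ℂ (Set.range fun i => compress P₀ (K i)), σ, τ, D,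
    hA.symm, hσ, hD, ?_, hFix', ?_⟩
  · rw [hσ, hDA, hFix']
  · rw [← hA, ← map_compress_Fix_hsAdjoint hE hK hsand, Submodule.map_coe, Set.image_image]
    rfl
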